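/- Let $a_+,a_->0$. For $\delta=+,-$ put $s_\delta(z)=\sinh(\pi z/a_\delta)$ and $c_\delta(z)=\cosh(\pi z/a_\delta)$. Let $G(z)=G(a_+,a_-;z)$ be the hyperbolic gamma function: the meromorphic function on $\mathbb C$ given by $$G(z)=\exp\left(i\int_0^\infty\frac{dy}{y}\left(\frac{\sin 2yz}{2\sinh(a_+y)\sinh(a_-y)}-\frac{z}{a_+a_-y}\right)\right),\qquad |\mathrm{Im}\,z|<\tfrac{1}{2}(a_++a_-),$$ and continued to $\mathbb C$ by the difference equation $G(z+ia_+/2)=2c_-(z)\,G(z-ia_+/2)$. Its poles are the points $-\tfrac i2(a_++a_-)-ika_+-ila_-$ with $k,l\in\{0,1,2,\dots\}$. For $b\in\mathbb C$ define the kernel function $$K(b;x,v)=\prod_{\delta_1,\delta_2=+,-}G\big((\delta_1x+\delta_2v-ib)/2\big),$$ and define the $A_1$ relativistic Calogero–Moser difference operators, acting on functions of $x$, by $$\big(A_\delta(b;x)f\big)(x)=\frac{s_\delta(x-ib)}{s_\delta(x)}f(x-ia_{-\delta})+\frac{s_\delta(x+ib)}{s_\delta(x)}f(x+ia_{-\delta}).$$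 **Proposition 3.1.** Let $b,d\in\mathbb C$ and $\delta\in\{+,-\}$. The following three identities hold for all $x,v\in\mathbb C$ at which the denominators occurring in the identity are nonzero and no $G$-factor of the values of $K$ occurring in it is evaluated at a pole of $G$ (hence they hold as identities of meromorphic functions of $(x,v)\in\mathbb C^2$). 1. $$\frac{s_\delta(x-ib+id)}{s_\delta(x)}K(b;x-ia_{-\delta},v)+\frac{s_\delta(x+ib-id)}{s_\delta(x)}K(b;x+ia_{-\delta},v)$$ $$=\frac{s_\delta(v-id)}{s_\delta(v)}K(b;x,v-ia_{-\delta})+\frac{s_\delta(v+id)}{s_\delta(v)}K(b;x,v+ia_{-\delta}),$$ that is, $A_\delta(b-d;x)K(b;x,v)=A_\delta(d;v)K(b;x,v)$. 2. $$\frac{s_\delta(x-ib)}{s_\delta(x)}K(b;x-2ia_{-\delta},v)+\frac{s_\delta(x+ib)}{s_\delta(x)}K(b;x+2ia_{-\delta},v)$$ $$=\frac{s_\delta(v-ib)}{s_\delta(v)}K(b;x,v-2ia_{-\delta})+\frac{s_\delta(v+ib)}{s_\delta(v)}K(b;x,v+2ia_{-\delta}).$$ 3. $$\frac{s_\delta((x-ib)/2)}{s_\delta(x/2)}K(b;x-ia_{-\delta},v)+\frac{s_\delta((x+ib)/2)}{s_\delta(x/2)}K(b;x+ia_{-\delta},v)$$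 $$=\frac{s_\delta((v-ib)/2)}{s_\delta(v/2)}K(b;x,v-ia_{-\delta})+\frac{s_\delta((v+ib)/2)}{s_\delta(v/2)}K(b;x,v+ia_{-\delta}).$$ -/

import Mathlib

namespace RelCalogero

noncomputable section

open Complex MeasureTheory

/-! The parameters `a₊, a₋` are the values at `1` and `-1` of a function `a : ℤˣ → ℝ`; the index
`δ = +, -` runs through `ℤˣ = {1, -1}`. -/

/-- `s_δ(z) = sinh (π z / a_δ)`. -/
def s (a : ℤˣ → ℝ) (δ : ℤˣ) (z : ℂ) : ℂ := Complex.sinh (Real.pi * z / a δ)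

/-- `c_δ(z) = cosh (π z / a_δ)`. -/
def c (a : ℤˣ → ℝ) (δ : ℤˣ) (z : ℂ) : ℂ := Complex.cosh (Real.pi * z / a δ)

/-- The integral representation of `g(a₊, a₋; z)`, absolutely convergent in the strip
`|Im z| < (a₊ + a₋) / 2`. -/
def g (a : ℤˣ → ℝ) (z : ℂ) : ℂ :=
  ∫ y in Set.Ioi (0 : ℝ), (1 / (y : ℂ)) *
    (Complex.sin (2 * y * z) /
        (2 * Complex.sinh ((a 1 : ℂ) * y) * Complex.sinh ((a (-1) : ℂ) * y))
      - z / ((a 1 : ℂ) * (a (-1) : ℂ) * y))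

/-- The integer `N` with `-1/2 ≤ Im z / a₊ - N < 1/2`. In particular `z - i N a₊` lies in the strip
`|Im w| ≤ a₊ / 2`, inside the strip `|Im w| < (a₊ + a₋) / 2`. -/
def level (a : ℤˣ → ℝ) (z : ℂ) : ℤ := round (z.im / a 1)

/-- The hyperbolic gamma function `G(a₊, a₋; z)`: it is `exp (i g(z))` in the strip around the real
axis, meromorphically continued to the whole plane by means of
`G(w + i a₊ / 2) = 2 c₋(w) G(w - i a₊ / 2)`. At a pole one of the factors in the denominator
vanishes, and the value there is `0` by convention. -/
def G (a : ℤˣ → ℝ) (z : ℂ) : ℂ :=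
  (∏ j ∈ Finset.range (level a z).toNat, 2 * c a (-1) (z - I * ((j : ℂ) + 1 / 2) * a 1)) /
    (∏ j ∈ Finset.range (-level a z).toNat, 2 * c a (-1) (z + I * ((j : ℂ) + 1 / 2) * a 1)) *
    Complex.exp (I * g a (z - I * (level a z : ℂ) * a 1))

/-- The poles of `G`: the points `-i (a₊ + a₋) / 2 - i k a₊ - i l a₋` with `k, l = 0, 1, 2, …`. -/
def IsGPole (a : ℤˣ → ℝ) (z : ℂ) : Prop :=
  ∃ k l : ℕ, z = -(I * ((a 1 : ℂ) + a (-1)) / 2) - I * k * a 1 - I * l * a (-1)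

/-- The argument `(δ₁ x + δ₂ v - i b) / 2` of a factor of the kernel function. -/
def kernelArg (b x v : ℂ) (δ₁ δ₂ : ℤˣ) : ℂ :=
  (((δ₁ : ℤ) : ℂ) * x + ((δ₂ : ℤ) : ℂ) * v - I * b) / 2

/-- The kernel function `K(b; x, v) = ∏_{δ₁, δ₂ = +, -} G((δ₁ x + δ₂ v - i b) / 2)`. -/
def K (a : ℤˣ → ℝ) (b x v : ℂ) : ℂ :=
  ∏ δ₁ : ℤˣ, ∏ δ₂ : ℤˣ, G a (kernelArg b x v δ₁ δ₂)

/-- No factor of `K(b; ·, ·)` has a pole at `(x, v)`. -/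
def KRegular (a : ℤˣ → ℝ) (b x v : ℂ) : Prop :=
  ∀ δ₁ δ₂ : ℤˣ, ¬ IsGPole a (kernelArg b x v δ₁ δ₂)

/-- The translation `(T_t f)(z) = f(z - t)`. -/
def T (t : ℂ) (f : ℂ → ℂ) (z : ℂ) : ℂ := f (z - t)

/-- The `A₁` relativistic Calogero-Moser difference operator
`A_δ(b; x) = (s_δ(x - i b) / s_δ(x)) T_{i a_{-δ}} + (s_δ(x + i b) / s_δ(x)) T_{-i a_{-δ}}`. -/
def A (a : ℤˣ → ℝ) (δ : ℤˣ) (b : ℂ) (f : ℂ → ℂ) (x : ℂ) : ℂ :=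
  s a δ (x - I * b) / s a δ x * T (I * a (-δ)) f x +
    s a δ (x + I * b) / s a δ x * T (-(I * a (-δ))) f x

end

end RelCalogero

namespace RelCalogero

open Complex MeasureTheory Filter Topology

/-! Under a shift of `x` or `v` by `±t`, each of the four arguments of the `G`-factors moves by
`±t/2`. Let `M` be the product of `G` at the four lowered arguments. Each shifted value of `K`
raises exactly two arguments, and the difference equation of `G` turns it into `M` times two
hyperbolic factors (`K_shift`, `K_single_shift`, `K_double_shift`). After removal of `M`, each
identity says that a sum of two `sinh` ratios times such factors equals a function that is invariant
under interchanging the roles of `x` and `v`. These invariants are displayed in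
`sinh_mul_cosh_add_cosh` (where the interchange also sends `D` to `B - D`),
`sinh_mul_cosh_add_const_mul` and `sinh_half_mul_cosh_add_cosh`.

The analytic input is that `G` obeys both difference equations away from its poles (`G_add_I_mul`).
The `a₊`-equation is essentially built into the definition. The `a₋`-equation comes from the
integral: the difference of two shifted integrals is an integral representation of `log (2 cosh)`
(`exp_integral_logCoshIntegrand`). Its derivative is `(π/p) tanh (πz/p)`, by a geometric expansion
and the partial fractions of the cotangent, and a duplication formula fixes the remaining constant.
The equation first holds in a strip of width `a₊`, and the `a₊`-equation carries it to the whole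
plane. -/

/-- The integrand of the integral representation of `g(p, q; z)`. -/
noncomputable def gIntegrand (p q : ℝ) (z : ℂ) (y : ℝ) : ℂ :=
  (1 / (y : ℂ)) *
    (Complex.sin (2 * y * z) / (2 * Complex.sinh ((p : ℂ) * y) * Complex.sinh ((q : ℂ) * y))
      - z / ((p : ℂ) * (q : ℂ) * y))

/-! ### Convergence and continuity of the integral for `g` -/

lemma norm_sin_le_exp_abs_im (w : ℂ) : ‖Complex.sin w‖ ≤ Real.exp |w.im| := by
  have h : Complex.sin w = (Complex.exp (-w * I) - Complex.exp (w * I)) * I / 2 := rfl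
  rw [h, norm_div, norm_mul, norm_I, mul_one]
  have h1 : ‖Complex.exp (-w * I)‖ ≤ Real.exp |w.im| := by
    rw [norm_exp]
    apply Real.exp_le_exp.2
    simpa using le_abs_self w.im
  have h2 : ‖Complex.exp (w * I)‖ ≤ Real.exp |w.im| := by
    rw [norm_exp]
    apply Real.exp_le_exp.2
    simpa using neg_le_abs w.im
  have h3 := norm_sub_le (Complex.exp (-w * I)) (Complex.exp (w * I))
  have h4 : ‖(2 : ℂ)‖ = 2 := by simp
  rw [h4]
  linarith

/-- The quadratic Taylor terms of the two exponentials cancel, leaving two remainders of order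
three. Order three is what compensates the `y³` in the denominator of the integrand near `0`. -/
lemma norm_sin_sub_self_le (w : ℂ) : ‖Complex.sin w - w‖ ≤ ‖w‖ ^ 3 * Real.exp ‖w‖ := by
  have h1 := norm_exp_sub_sum_le_norm_mul_exp (-w * I) 3
  have h2 := norm_exp_sub_sum_le_norm_mul_exp (w * I) 3
  have h : Complex.sin w - w =
      ((Complex.exp (-w * I) - ∑ m ∈ Finset.range 3, (-w * I) ^ m / m.factorial) -
        (Complex.exp (w * I) - ∑ m ∈ Finset.range 3, (w * I) ^ m / m.factorial)) * I / 2 := by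
    have h0 : Complex.sin w = (Complex.exp (-w * I) - Complex.exp (w * I)) * I / 2 := rfl
    rw [h0]
    simp only [Finset.sum_range_succ, Finset.sum_range_zero]
    simp [Nat.factorial]
    ring_nf
    simp [I_sq]
  have h3 := norm_sub_le (Complex.exp (-w * I) - ∑ m ∈ Finset.range 3, (-w * I) ^ m / m.factorial)
    (Complex.exp (w * I) - ∑ m ∈ Finset.range 3, (w * I) ^ m / m.factorial)
  rw [h, norm_div, norm_mul, norm_I, mul_one]
  have h4 : ‖(2 : ℂ)‖ = 2 := by simp
  have h5 : ‖-w * I‖ = ‖w‖ := by simp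
  have h6 : ‖w * I‖ = ‖w‖ := by simp
  rw [h5] at h1
  rw [h6] at h2
  rw [h4]
  linarith

lemma norm_sin_le_norm_mul_exp (w : ℂ) : ‖Complex.sin w‖ ≤ ‖w‖ * Real.exp ‖w‖ := by
  have h1 := norm_exp_sub_sum_le_norm_mul_exp (-w * I) 1
  have h2 := norm_exp_sub_sum_le_norm_mul_exp (w * I) 1
  have h : Complex.sin w =
      ((Complex.exp (-w * I) - ∑ m ∈ Finset.range 1, (-w * I) ^ m / m.factorial) -
        (Complex.exp (w * I) - ∑ m ∈ Finset.range 1, (w * I) ^ m / m.factorial)) * I / 2 := by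
    have h0 : Complex.sin w = (Complex.exp (-w * I) - Complex.exp (w * I)) * I / 2 := rfl
    rw [h0]
    simp
  have h3 := norm_sub_le (Complex.exp (-w * I) - ∑ m ∈ Finset.range 1, (-w * I) ^ m / m.factorial)
    (Complex.exp (w * I) - ∑ m ∈ Finset.range 1, (w * I) ^ m / m.factorial)
  rw [h, norm_div, norm_mul, norm_I, mul_one]
  have h4 : ‖(2 : ℂ)‖ = 2 := by simp
  have h5 : ‖-w * I‖ = ‖w‖ := by simp
  have h6 : ‖w * I‖ = ‖w‖ := by simp
  rw [h5] at h1
  rw [h6] at h2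
  rw [h4]
  linarith

/-- From `t ≤ sinh t ≤ t cosh t ≤ t exp (t²/2)` the product of the two `sinh` lies between `p q y²`
and `p q y² exp E` with `E` of order `y²`; then `1 - E ≤ exp (-E)` gives a bound independent of `y`.
-/
lemma abs_inv_sinh_mul_sinh_sub_le {p q y : ℝ} (hp : 0 < p) (hq : 0 < q) (hy : 0 < y) :
    |1 / (Real.sinh (p * y) * Real.sinh (q * y)) - 1 / (p * q * y ^ 2)| ≤
      (p ^ 2 + q ^ 2) / (2 * (p * q)) := by
  have hpy : 0 < p * y := by positivity
  have hqy : 0 < q * y := by positivity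
  have s1 : p * y ≤ Real.sinh (p * y) := (Real.self_le_sinh_iff).2 hpy.le
  have s2 : q * y ≤ Real.sinh (q * y) := (Real.self_le_sinh_iff).2 hqy.le
  have key : ∀ t : ℝ, 0 < t → Real.sinh t ≤ t * Real.exp (t ^ 2 / 2) := by
    intro t ht
    refine le_trans ?_ (mul_le_mul_of_nonneg_left (Real.cosh_le_exp_half_sq t) ht.le)
    have hm : MonotoneOn (fun t => t * Real.cosh t - Real.sinh t) (Set.Ici 0) := by
      refine monotoneOn_of_deriv_nonneg (convex_Ici 0) (by fun_prop) (by fun_prop) ?_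
      intro u hu
      simp only [interior_Ici, Set.mem_Ioi] at hu
      have hd : HasDerivAt (fun t => t * Real.cosh t - Real.sinh t)
          (1 * Real.cosh u + u * Real.sinh u - Real.cosh u) u :=
        ((hasDerivAt_id u).mul (Real.hasDerivAt_cosh u)).sub (Real.hasDerivAt_sinh u)
      rw [hd.deriv]
      have := Real.sinh_pos_iff.2 hu
      nlinarith [mul_pos hu this]
    have := hm (by simp) (Set.mem_Ici.2 ht.le) ht.le
    simp at this
    linarith
  have k1 := key _ hpy
  have k2 := key _ hqy
  have hS : 0 < Real.sinh (p * y) * Real.sinh (q * y) :=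
    mul_pos (Real.sinh_pos_iff.2 hpy) (Real.sinh_pos_iff.2 hqy)
  have hlow : p * q * y ^ 2 ≤ Real.sinh (p * y) * Real.sinh (q * y) := by
    calc p * q * y ^ 2 = (p * y) * (q * y) := by ring
      _ ≤ _ := mul_le_mul s1 s2 hqy.le (hpy.le.trans s1)
  have hpos : 0 < p * q * y ^ 2 := by positivity
  set E := ((p ^ 2 + q ^ 2) * y ^ 2 / 2) with hE
  have hup : Real.sinh (p * y) * Real.sinh (q * y) ≤ p * q * y ^ 2 * Real.exp E := by
    calc _ ≤ (p * y * Real.exp ((p * y) ^ 2 / 2)) * (q * y * Real.exp ((q * y) ^ 2 / 2)) :=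
          mul_le_mul k1 k2 (hqy.le.trans s2) (by positivity)
      _ = p * q * y ^ 2 * (Real.exp ((p * y) ^ 2 / 2) * Real.exp ((q * y) ^ 2 / 2)) := by ring
      _ = _ := by
        rw [← Real.exp_add]
        congr 2
        rw [hE]; ring
  rw [abs_sub_comm, abs_of_nonneg (sub_nonneg.2 (one_div_le_one_div_of_le hpos hlow))]
  have h1 : 1 / (p * q * y ^ 2 * Real.exp E) ≤ 1 / (Real.sinh (p * y) * Real.sinh (q * y)) :=
    one_div_le_one_div_of_le hS hup
  have h2 : 1 - E ≤ Real.exp (-E) := by linarith [Real.add_one_le_exp (-E)]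
  have h3 : 1 / (p * q * y ^ 2 * Real.exp E) = 1 / (p * q * y ^ 2) * Real.exp (-E) := by
    rw [Real.exp_neg]; field_simp
  have h4 : 1 / (p * q * y ^ 2) * (1 - E) ≤ 1 / (p * q * y ^ 2) * Real.exp (-E) :=
    mul_le_mul_of_nonneg_left h2 (by positivity)
  have h5 : 1 / (p * q * y ^ 2) * (1 - E) = 1 / (p * q * y ^ 2) - (p ^ 2 + q ^ 2) / (2 * (p * q)) := by
    rw [hE]; field_simp
  linarith

lemma mul_exp_le_sinh {p y : ℝ} (hp : 0 < p) (hy : 1 ≤ y) :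
    (1 - Real.exp (-2 * p)) / 2 * Real.exp (p * y) ≤ Real.sinh (p * y) := by
  rw [Real.sinh_eq]
  have h : Real.exp (-(p * y)) ≤ Real.exp (-2 * p) * Real.exp (p * y) := by
    rw [← Real.exp_add]
    apply Real.exp_le_exp.2
    nlinarith
  linarith

lemma ofReal_sinh_mul (p y : ℝ) : Complex.sinh ((p : ℂ) * y) = (Real.sinh (p * y) : ℝ) := by
  push_cast; rfl

/-- A bound that is constant on `(0, 1]` and exponentially decaying up to an inverse square
on `(1, ∞)`. -/
noncomputable def tailBound (A B C κ y : ℝ) : ℝ :=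
  (Set.Ioc 0 1).indicator (fun _ => A) y +
    (Set.Ioi 1).indicator (fun y => B * Real.exp (-κ * y) + C * y ^ (-2 : ℝ)) y

lemma integrableOn_tailBound (A B C : ℝ) {κ : ℝ} (hκ : 0 < κ) :
    IntegrableOn (tailBound A B C κ) (Set.Ioi 0) := by
  unfold tailBound
  apply Integrable.integrableOn
  apply Integrable.add
  · rw [integrable_indicator_iff measurableSet_Ioc]
    exact integrableOn_const (by simp)
  · rw [integrable_indicator_iff measurableSet_Ioi]
    apply Integrable.add
    · exact (integrableOn_exp_mul_Ioi (by linarith) 1).const_mul B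
    · exact (integrableOn_Ioi_rpow_of_lt (by norm_num) one_pos).const_mul C

lemma le_tailBound {A B C κ y t : ℝ} (hy : 0 < y) (h1 : y ≤ 1 → t ≤ A)
    (h2 : 1 < y → t ≤ B * Real.exp (-κ * y) + C * y ^ (-2 : ℝ)) : t ≤ tailBound A B C κ y := by
  unfold tailBound
  rcases le_or_gt y 1 with h | h
  · simpa [hy, h, not_lt.2 h] using h1 h
  · simpa [hy, h, not_le.2 h] using h2 h

/-- Near `0` the singularities of the two terms cancel; at infinity the sine grows at most like `exp
(2ηy)`, which loses against `exp ((p + q) y)`, and the subtracted term contributes the `y⁻²`. The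
bound is uniform in `z`, so it serves both integrability and continuity. -/
lemma exists_bound_gIntegrand {p q : ℝ} (hp : 0 < p) (hq : 0 < q) (M : ℝ) {η : ℝ}
    (hη : 2 * η < p + q) :
    ∃ bound : ℝ → ℝ, IntegrableOn bound (Set.Ioi 0) ∧
      ∀ z : ℂ, ‖z‖ ≤ M → |z.im| ≤ η → ∀ y : ℝ, 0 < y → ‖gIntegrand p q z y‖ ≤ bound y := by
  set cp := (1 - Real.exp (-2 * p)) / 2 with hcp
  set cq := (1 - Real.exp (-2 * q)) / 2 with hcq
  have hcp0 : 0 < cp := by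
    have : Real.exp (-2 * p) < 1 := Real.exp_lt_one_iff.2 (by linarith)
    rw [hcp]; linarith
  have hcq0 : 0 < cq := by
    have : Real.exp (-2 * q) < 1 := Real.exp_lt_one_iff.2 (by linarith)
    rw [hcq]; linarith
  refine ⟨tailBound ((2 * M) ^ 3 * Real.exp (2 * M) / (2 * (p * q)) +
    M * ((p ^ 2 + q ^ 2) / (2 * (p * q)))) (1 / (2 * (cp * cq))) (M / (p * q)) (p + q - 2 * η),
    integrableOn_tailBound _ _ _ (by linarith), ?_⟩
  intro z hz hzi y hy
  have hM : 0 ≤ M := (norm_nonneg z).trans hz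
  have hsp : 0 < Real.sinh (p * y) := Real.sinh_pos_iff.2 (by positivity)
  have hsq : 0 < Real.sinh (q * y) := Real.sinh_pos_iff.2 (by positivity)
  have s1 : p * y ≤ Real.sinh (p * y) := (Real.self_le_sinh_iff).2 (by positivity)
  have s2 : q * y ≤ Real.sinh (q * y) := (Real.self_le_sinh_iff).2 (by positivity)
  have hyC : (y : ℂ) ≠ 0 := by exact_mod_cast hy.ne'
  have hpC : (p : ℂ) ≠ 0 := by exact_mod_cast hp.ne'
  have hqC : (q : ℂ) ≠ 0 := by exact_mod_cast hq.ne'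
  have hspC : ((Real.sinh (p * y) : ℝ) : ℂ) ≠ 0 := by exact_mod_cast hsp.ne'
  have hsqC : ((Real.sinh (q * y) : ℝ) : ℂ) ≠ 0 := by exact_mod_cast hsq.ne'
  have hnw : ‖2 * (y : ℂ) * z‖ = 2 * y * ‖z‖ := by
    simp [abs_of_pos hy]
  apply le_tailBound hy
  · intro hy1
    -- Inserting `2yz / (2y sinh sinh)` separates the error of `sin w ≈ w` from the error of `sinh
    -- sinh ≈ p q y²`; each is bounded on `(0, 1]`.
    have hsplit : gIntegrand p q z y =
        (Complex.sin (2 * y * z) - 2 * y * z) /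
          ((y * (2 * (Real.sinh (p * y) * Real.sinh (q * y))) : ℝ) : ℂ) +
        z * ((1 / (Real.sinh (p * y) * Real.sinh (q * y)) - 1 / (p * q * y ^ 2) : ℝ) : ℂ) := by
      unfold gIntegrand
      rw [ofReal_sinh_mul, ofReal_sinh_mul]
      push_cast [-Complex.ofReal_sinh]
      field_simp
      ring
    rw [hsplit]
    refine (norm_add_le _ _).trans (add_le_add ?_ ?_)
    · rw [norm_div, Complex.norm_of_nonneg (by positivity)]
      have hw : ‖2 * (y : ℂ) * z‖ ≤ 2 * M * y := by
        rw [hnw]; nlinarith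
      have h1 : ‖Complex.sin (2 * y * z) - 2 * y * z‖ ≤ (2 * M * y) ^ 3 * Real.exp (2 * M) := by
        refine (norm_sin_sub_self_le _).trans ?_
        gcongr
        exact hw.trans (by nlinarith)
      have h2 : y * (2 * (p * y * (q * y))) ≤ y * (2 * (Real.sinh (p * y) * Real.sinh (q * y))) := by
        gcongr
      calc _ ≤ ((2 * M * y) ^ 3 * Real.exp (2 * M)) / (y * (2 * (p * y * (q * y)))) := by
            gcongr
        _ = _ := by field_simp
    · rw [norm_mul, Complex.norm_real, Real.norm_eq_abs]
      exact mul_le_mul hz (abs_inv_sinh_mul_sinh_sub_le hp hq hy) (abs_nonneg _) hM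
  · intro hy1
    have hsplit : gIntegrand p q z y =
        Complex.sin (2 * y * z) / ((y * (2 * (Real.sinh (p * y) * Real.sinh (q * y))) : ℝ) : ℂ)
          - z / ((p * q * y ^ 2 : ℝ) : ℂ) := by
      unfold gIntegrand
      rw [ofReal_sinh_mul, ofReal_sinh_mul]
      push_cast [-Complex.ofReal_sinh]
      field_simp
    rw [hsplit]
    refine (norm_sub_le _ _).trans (add_le_add ?_ ?_)
    · rw [norm_div, Complex.norm_of_nonneg (by positivity)]
      have h1 : ‖Complex.sin (2 * y * z)‖ ≤ Real.exp (2 * y * η) := by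
        refine (norm_sin_le_exp_abs_im _).trans (Real.exp_le_exp.2 ?_)
        have : (2 * (y : ℂ) * z).im = 2 * y * z.im := by
          simp [mul_assoc]
        rw [this, abs_mul, abs_of_pos (by positivity)]
        gcongr
      have h2 : 1 * (2 * ((cp * Real.exp (p * y)) * (cq * Real.exp (q * y)))) ≤
          y * (2 * (Real.sinh (p * y) * Real.sinh (q * y))) := by
        have e1 := mul_exp_le_sinh hp hy1.le
        have e2 := mul_exp_le_sinh hq hy1.le
        gcongr
      calc _ ≤ Real.exp (2 * y * η) /
            (1 * (2 * ((cp * Real.exp (p * y)) * (cq * Real.exp (q * y))))) := by gcongr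
        _ = 1 / (2 * (cp * cq)) * Real.exp (-(p + q - 2 * η) * y) := by
          have : -(p + q - 2 * η) * y = 2 * y * η - p * y - q * y := by ring
          rw [this, Real.exp_sub, Real.exp_sub]
          field_simp
    · rw [norm_div, Complex.norm_of_nonneg (by positivity)]
      have : y ^ (-2 : ℝ) = (y ^ 2)⁻¹ := by
        rw [Real.rpow_neg hy.le]; norm_num
      rw [this]
      calc ‖z‖ / (p * q * y ^ 2) ≤ M / (p * q * y ^ 2) := by gcongr
        _ = _ := by field_simp

lemma continuousOn_gIntegrand {p q : ℝ} (hp : 0 < p) (hq : 0 < q) (z : ℂ) :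
    ContinuousOn (gIntegrand p q z) (Set.Ioi 0) := by
  have hs : ∀ r : ℝ, 0 < r → ∀ y ∈ Set.Ioi (0 : ℝ), Complex.sinh ((r : ℂ) * y) ≠ 0 := by
    intro r hr y hy
    rw [ofReal_sinh_mul]
    exact_mod_cast (Real.sinh_pos_iff.2 (mul_pos hr hy)).ne'
  have hy0 : ∀ y ∈ Set.Ioi (0 : ℝ), (y : ℂ) ≠ 0 := by
    intro y hy
    exact_mod_cast (Set.mem_Ioi.1 hy).ne'
  have hpC : (p : ℂ) ≠ 0 := by exact_mod_cast hp.ne'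
  have hqC : (q : ℂ) ≠ 0 := by exact_mod_cast hq.ne'
  unfold gIntegrand
  refine ContinuousOn.mul (ContinuousOn.div (by fun_prop) (by fun_prop) hy0)
    (ContinuousOn.sub (ContinuousOn.div (by fun_prop) (by fun_prop) ?_)
      (ContinuousOn.div (by fun_prop) (by fun_prop) ?_))
  · intro y hy
    exact mul_ne_zero (mul_ne_zero two_ne_zero (hs p hp y hy)) (hs q hq y hy)
  · intro y hy
    exact mul_ne_zero (mul_ne_zero hpC hqC) (hy0 y hy)

lemma aestronglyMeasurable_gIntegrand {p q : ℝ} (hp : 0 < p) (hq : 0 < q) (z : ℂ) :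
    AEStronglyMeasurable (gIntegrand p q z) (volume.restrict (Set.Ioi 0)) :=
  (continuousOn_gIntegrand hp hq z).aestronglyMeasurable measurableSet_Ioi

lemma integrableOn_gIntegrand {p q : ℝ} (hp : 0 < p) (hq : 0 < q) {z : ℂ}
    (hz : |z.im| < (p + q) / 2) : IntegrableOn (gIntegrand p q z) (Set.Ioi 0) := by
  obtain ⟨bound, hb, h⟩ := exists_bound_gIntegrand hp hq ‖z‖ (η := |z.im|) (by linarith)
  refine Integrable.mono' hb (aestronglyMeasurable_gIntegrand hp hq z) ?_
  filter_upwards [ae_restrict_mem measurableSet_Ioi] with y hy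
  exact h z le_rfl le_rfl y hy

lemma continuousAt_integral_gIntegrand {p q : ℝ} (hp : 0 < p) (hq : 0 < q) {z : ℂ}
    (hz : |z.im| < (p + q) / 2) :
    ContinuousAt (fun z => ∫ y in Set.Ioi (0 : ℝ), gIntegrand p q z y) z := by
  obtain ⟨η, h1, h2⟩ := exists_between hz
  obtain ⟨bound, hb, h⟩ := exists_bound_gIntegrand hp hq (‖z‖ + 1) (η := η) (by linarith)
  refine continuousAt_of_dominated (bound := bound)
    (Filter.Eventually.of_forall fun w => aestronglyMeasurable_gIntegrand hp hq w) ?_ hb ?_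
  · have e1 : ∀ᶠ w : ℂ in nhds z, ‖w‖ < ‖z‖ + 1 :=
      continuous_norm.continuousAt.eventually_lt continuousAt_const (by simp)
    have e2 : ∀ᶠ w : ℂ in nhds z, |w.im| < η :=
      (continuous_abs.comp continuous_im).continuousAt.eventually_lt continuousAt_const h1
    filter_upwards [e1, e2] with w hw1 hw2
    filter_upwards [ae_restrict_mem measurableSet_Ioi] with y hy
    exact h w hw1.le hw2.le y hy
  · refine Filter.Eventually.of_forall fun y => ?_
    unfold gIntegrand
    fun_prop

/-! ### An integral representation of `log (2 cosh (πz/p))` -/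

/-- The integrand of the integral representation of `log (2 cosh (π z / p))`. -/
noncomputable def logCoshIntegrand (p : ℝ) (z : ℂ) (y : ℝ) : ℂ :=
  (1 / (y : ℂ)) * (1 / ((p : ℂ) * y) - Complex.cos (2 * y * z) / Complex.sinh ((p : ℂ) * y))

lemma sinh_ofReal_mul_ne_zero {p y : ℝ} (hp : 0 < p) (hy : 0 < y) :
    Complex.sinh ((p : ℂ) * y) ≠ 0 := by
  rw [ofReal_sinh_mul]
  exact_mod_cast (Real.sinh_pos_iff.2 (mul_pos hp hy)).ne'

/-- In `sin (u + iqy) - sin (u - iqy) = 2i cos u sinh (qy)` the factor `sinh (qy)` cancels against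
the denominator, so `q` disappears. -/
lemma gIntegrand_sub {p q : ℝ} (hp : 0 < p) (hq : 0 < q) (z : ℂ) {y : ℝ} (hy : 0 < y) :
    gIntegrand p q (z + I * q / 2) y - gIntegrand p q (z - I * q / 2) y =
      -I * logCoshIntegrand p z y := by
  have h1 := sinh_ofReal_mul_ne_zero hp hy
  have h2 := sinh_ofReal_mul_ne_zero hq hy
  have hy0 : (y : ℂ) ≠ 0 := by exact_mod_cast hy.ne'
  have hp0 : (p : ℂ) ≠ 0 := by exact_mod_cast hp.ne'
  have hq0 : (q : ℂ) ≠ 0 := by exact_mod_cast hq.ne'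
  unfold gIntegrand logCoshIntegrand
  have e1 : 2 * (y : ℂ) * (z + I * q / 2) = 2 * y * z + (q * y) * I := by ring
  have e2 : 2 * (y : ℂ) * (z - I * q / 2) = 2 * y * z - (q * y) * I := by ring
  rw [e1, e2, Complex.sin_add, Complex.sin_sub, Complex.sin_mul_I, Complex.cos_mul_I]
  generalize Complex.sinh ((p : ℂ) * y) = P at *
  generalize Complex.sinh ((q : ℂ) * y) = Q at *
  field_simp
  ring

lemma integrableOn_gIntegrand_add {p q : ℝ} (hp : 0 < p) (hq : 0 < q) {z : ℂ}
    (hz : |z.im| < p / 2) : IntegrableOn (gIntegrand p q (z + I * q / 2)) (Set.Ioi 0) := by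
  apply integrableOn_gIntegrand hp hq
  have := abs_lt.1 hz
  simp only [add_im, div_ofNat_im, mul_im, I_re, I_im, ofReal_im, ofReal_re]
  rw [abs_lt]
  constructor <;> linarith

lemma integrableOn_gIntegrand_sub {p q : ℝ} (hp : 0 < p) (hq : 0 < q) {z : ℂ}
    (hz : |z.im| < p / 2) : IntegrableOn (gIntegrand p q (z - I * q / 2)) (Set.Ioi 0) := by
  apply integrableOn_gIntegrand hp hq
  have := abs_lt.1 hz
  simp only [sub_im, div_ofNat_im, mul_im, I_re, I_im, ofReal_im, ofReal_re]
  rw [abs_lt]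
  constructor <;> linarith

/-- The choice `q = p` lets measurability and integrability be inherited from `gIntegrand`, without
new estimates. -/
lemma logCoshIntegrand_eq {p : ℝ} (hp : 0 < p) (z : ℂ) {y : ℝ} (hy : 0 < y) :
    logCoshIntegrand p z y =
      I * (gIntegrand p p (z + I * p / 2) y - gIntegrand p p (z - I * p / 2) y) := by
  rw [gIntegrand_sub hp hp z hy, ← mul_assoc]
  simp

lemma aestronglyMeasurable_logCoshIntegrand {p : ℝ} (hp : 0 < p) (z : ℂ) :
    AEStronglyMeasurable (logCoshIntegrand p z) (volume.restrict (Set.Ioi 0)) := by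
  refine (((aestronglyMeasurable_gIntegrand hp hp (z + I * p / 2)).sub
    (aestronglyMeasurable_gIntegrand hp hp (z - I * p / 2))).const_mul I).congr ?_
  filter_upwards [ae_restrict_mem measurableSet_Ioi] with y hy
  exact (logCoshIntegrand_eq hp z hy).symm

lemma integrableOn_logCoshIntegrand {p : ℝ} (hp : 0 < p) {z : ℂ} (hz : |z.im| < p / 2) :
    IntegrableOn (logCoshIntegrand p z) (Set.Ioi 0) := by
  refine (((integrableOn_gIntegrand_add hp hp hz).sub
    (integrableOn_gIntegrand_sub hp hp hz)).const_mul I).congr ?_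
  filter_upwards [ae_restrict_mem measurableSet_Ioi] with y hy
  exact (logCoshIntegrand_eq hp z hy).symm

lemma exists_bound_sin_div_sinh {p : ℝ} (hp : 0 < p) (M : ℝ) {η : ℝ} (hη : 2 * η < p) :
    ∃ bound : ℝ → ℝ, IntegrableOn bound (Set.Ioi 0) ∧
      ∀ z : ℂ, ‖z‖ ≤ M → |z.im| ≤ η → ∀ y : ℝ, 0 < y →
        ‖2 * Complex.sin (2 * y * z) / Complex.sinh ((p : ℂ) * y)‖ ≤ bound y := by
  set cp := (1 - Real.exp (-2 * p)) / 2 with hcp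
  have hcp0 : 0 < cp := by
    have : Real.exp (-2 * p) < 1 := Real.exp_lt_one_iff.2 (by linarith)
    rw [hcp]; linarith
  refine ⟨tailBound (4 * M * Real.exp (2 * M) / p) (2 / cp) 0 (p - 2 * η),
    integrableOn_tailBound _ _ _ (by linarith), ?_⟩
  intro z hz hzi y hy
  have hM : 0 ≤ M := (norm_nonneg z).trans hz
  have hsp : 0 < Real.sinh (p * y) := Real.sinh_pos_iff.2 (by positivity)
  have s1 : p * y ≤ Real.sinh (p * y) := (Real.self_le_sinh_iff).2 (by positivity)
  have hnw : ‖2 * (y : ℂ) * z‖ = 2 * y * ‖z‖ := by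
    simp [abs_of_pos hy]
  rw [ofReal_sinh_mul, norm_div, Complex.norm_of_nonneg hsp.le, norm_mul, Complex.norm_two]
  apply le_tailBound hy
  · intro hy1
    have hw : ‖2 * (y : ℂ) * z‖ ≤ 2 * M * y := by
      rw [hnw]; nlinarith
    have h1 : ‖Complex.sin (2 * y * z)‖ ≤ (2 * M * y) * Real.exp (2 * M) := by
      refine (norm_sin_le_norm_mul_exp _).trans ?_
      gcongr
      exact hw.trans (by nlinarith)
    calc _ ≤ 2 * ((2 * M * y) * Real.exp (2 * M)) / (p * y) := by gcongr
      _ = _ := by field_simp; ring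
  · intro hy1
    have h1 : ‖Complex.sin (2 * y * z)‖ ≤ Real.exp (2 * y * η) := by
      refine (norm_sin_le_exp_abs_im _).trans (Real.exp_le_exp.2 ?_)
      have : (2 * (y : ℂ) * z).im = 2 * y * z.im := by
        simp [mul_assoc]
      rw [this, abs_mul, abs_of_pos (by positivity)]
      gcongr
    have e1 := mul_exp_le_sinh hp hy1.le
    calc _ ≤ 2 * Real.exp (2 * y * η) / (cp * Real.exp (p * y)) := by gcongr
      _ = _ := by
        have : -(p - 2 * η) * y = 2 * y * η - p * y := by ring
        rw [this, Real.exp_sub]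
        field_simp
        ring

lemma aestronglyMeasurable_sin_div_sinh {p : ℝ} (hp : 0 < p) (z : ℂ) :
    AEStronglyMeasurable
      (fun y : ℝ => 2 * Complex.sin (2 * y * z) / Complex.sinh ((p : ℂ) * y))
      (volume.restrict (Set.Ioi 0)) := by
  refine ContinuousOn.aestronglyMeasurable ?_ measurableSet_Ioi
  exact ContinuousOn.div (by fun_prop) (by fun_prop)
    fun y hy => sinh_ofReal_mul_ne_zero hp hy

lemma hasDerivAt_integral_logCoshIntegrand {p : ℝ} (hp : 0 < p) {z : ℂ} (hz : |z.im| < p / 2) :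
    HasDerivAt (fun z => ∫ y in Set.Ioi (0 : ℝ), logCoshIntegrand p z y)
      (∫ y in Set.Ioi (0 : ℝ), 2 * Complex.sin (2 * y * z) / Complex.sinh ((p : ℂ) * y)) z := by
  obtain ⟨η, h1, h2⟩ := exists_between hz
  obtain ⟨bound, hb, h⟩ := exists_bound_sin_div_sinh hp (‖z‖ + 1) (η := η) (by linarith)
  have e1 : ∀ᶠ w : ℂ in 𝓝 z, ‖w‖ < ‖z‖ + 1 :=
    continuous_norm.continuousAt.eventually_lt continuousAt_const (by simp)
  have e2 : ∀ᶠ w : ℂ in 𝓝 z, |w.im| < η :=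
    (continuous_abs.comp continuous_im).continuousAt.eventually_lt continuousAt_const h1
  refine (hasDerivAt_integral_of_dominated_loc_of_deriv_le (e1.and e2)
    (Eventually.of_forall fun w => aestronglyMeasurable_logCoshIntegrand hp w)
    (integrableOn_logCoshIntegrand hp hz)
    (F' := fun z y => 2 * Complex.sin (2 * y * z) / Complex.sinh ((p : ℂ) * y))
    (aestronglyMeasurable_sin_div_sinh hp z) ?_ hb ?_).2
  · filter_upwards [ae_restrict_mem measurableSet_Ioi] with y hy
    intro w hw
    exact h w hw.1.le hw.2.le y hy
  · filter_upwards [ae_restrict_mem measurableSet_Ioi] with y hy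
    intro w _
    have hy0 : (y : ℂ) ≠ 0 := by exact_mod_cast (Set.mem_Ioi.1 hy).ne'
    have hd : HasDerivAt (fun w : ℂ => Complex.cos (2 * y * w))
        (-Complex.sin (2 * y * w) * (2 * y * 1)) w :=
      ((hasDerivAt_id w).const_mul (2 * (y : ℂ))).ccos
    have hd2 := ((hd.div_const (Complex.sinh ((p : ℂ) * y))).const_sub
      (1 / ((p : ℂ) * y))).const_mul (1 / (y : ℂ))
    unfold logCoshIntegrand
    refine hd2.congr_deriv ?_
    field_simp

/-- This is the cotangent expansion at `1/2 - w`, which is not an integer because its real part lies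
in `(0, 1)`. The poles are paired differently here, so the partial sums differ by one boundary term,
which tends to `0`. -/
lemma tendsto_sum_tan {w : ℂ} (hw : |w.re| < 1 / 2) :
    Tendsto (fun N : ℕ => ∑ k ∈ Finset.range N, (1 / ((k : ℂ) + 1 / 2 - w) - 1 / (k + 1 / 2 + w)))
      atTop (𝓝 (Real.pi * Complex.tan (Real.pi * w))) := by
  have hwr := abs_lt.1 hw
  have hx : (1 / 2 - w) ∈ integerComplement := by
    rw [mem_integerComplement_iff]
    rintro ⟨n, hn⟩
    have h := congrArg Complex.re hn
    simp at h
    have h1 : (0 : ℝ) < n := by rw [h]; linarith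
    have h2 : (n : ℝ) < 1 := by rw [h]; linarith
    have h1' : 0 < n := by exact_mod_cast h1
    have h2' : n < 1 := by exact_mod_cast h2
    omega
  have h := tendsto_logDeriv_euler_cot_sub hx
  have hne : ∀ k : ℕ, (k : ℂ) + 1 / 2 - w ≠ 0 := by
    intro k hk
    have := congrArg Complex.re hk
    simp at this
    have hk0 : (0 : ℝ) ≤ k := k.cast_nonneg
    linarith
  have hsum : ∀ N : ℕ, ∑ k ∈ Finset.range N, (1 / ((k : ℂ) + 1 / 2 - w) - 1 / (k + 1 / 2 + w)) =
      ∑ n ∈ Finset.range N, cotTerm (1 / 2 - w) n + 1 / (1 / 2 - w) - 1 / ((N : ℂ) + 1 / 2 - w) := by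
    intro N
    induction N with
    | zero => simp
    | succ N ih =>
      rw [Finset.sum_range_succ, ih, Finset.sum_range_succ]
      have e1 : (1 : ℂ) / 2 - w - (N + 1) = -(N + 1 / 2 + w) := by ring
      have e2 : (1 : ℂ) / 2 - w + (N + 1) = ((N + 1 : ℕ) : ℂ) + 1 / 2 - w := by push_cast; ring
      simp only [cotTerm]
      rw [e1, e2, div_neg]
      ring
  have hlim : Tendsto (fun N : ℕ => 1 / ((N : ℂ) + 1 / 2 - w)) atTop (𝓝 0) := by
    have h0 := tendsto_inv₀_cobounded.comp ((tendsto_add_const_cobounded (1 / 2 - w)).comp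
      (tendsto_natCast_atTop_cobounded (α := ℂ)))
    refine h0.congr fun N => ?_
    simp [add_sub_assoc]
  simp_rw [hsum]
  have := (h.add_const (1 / (1 / 2 - w))).sub hlim
  convert this using 2
  rw [Complex.cot, Complex.tan]
  have e : (Real.pi : ℂ) * (1 / 2 - w) = Real.pi / 2 - Real.pi * w := by ring
  rw [e, Complex.cos_pi_div_two_sub, Complex.sin_pi_div_two_sub]
  ring

lemma cosh_pi_mul_div_eq_zero_iff {p : ℝ} (hp : 0 < p) (z : ℂ) :
    Complex.cosh (Real.pi * z / p) = 0 ↔ ∃ m : ℤ, z = I * (m + 1 / 2) * p := by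
  have hp0 : (p : ℂ) ≠ 0 := by exact_mod_cast hp.ne'
  have hpi : (Real.pi : ℂ) ≠ 0 := by exact_mod_cast Real.pi_ne_zero
  rw [← Complex.cos_mul_I, Complex.cos_eq_zero_iff]
  constructor
  · rintro ⟨k, hk⟩
    refine ⟨-k - 1, ?_⟩
    field_simp at hk
    push_cast
    linear_combination (-I / 2) * hk + z * I_sq
  · rintro ⟨m, rfl⟩
    refine ⟨-m - 1, ?_⟩
    field_simp
    push_cast
    linear_combination ((2 * m + 1)) * I_sq

lemma cosh_pi_mul_div_ne_zero {p : ℝ} (hp : 0 < p) {z : ℂ} (hz : |z.im| < p / 2) :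
    Complex.cosh (Real.pi * z / p) ≠ 0 := by
  rw [Ne, cosh_pi_mul_div_eq_zero_iff hp]
  rintro ⟨m, rfl⟩
  have : (I * ((m : ℂ) + 1 / 2) * p).im = (m + 1 / 2) * p := by
    simp
  rw [this] at hz
  have h := abs_lt.1 hz
  have h1 : (-1 : ℝ) < m := by nlinarith
  have h2 : (m : ℝ) < 0 := by nlinarith
  have h1' : -1 < m := by exact_mod_cast h1
  have h2' : m < 0 := by exact_mod_cast h2
  omega

lemma integrableOn_sin_mul_exp {z : ℂ} {t : ℝ} (ht : 2 * |z.im| < t) :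
    IntegrableOn (fun y : ℝ => 4 * Complex.sin (2 * y * z) * Complex.exp (-t * y)) (Set.Ioi 0) ∧
      ∫ y in Set.Ioi (0 : ℝ), 4 * Complex.sin (2 * y * z) * Complex.exp (-t * y) =
        2 / I * (1 / (t - 2 * I * z) - 1 / (t + 2 * I * z)) := by
  have hz := abs_le.1 (le_refl |z.im|)
  have r1 : (2 * I * z - t).re < 0 := by simp; linarith
  have r2 : (-(2 * I * z) - t).re < 0 := by simp; linarith
  have n1 : (2 * I * z - t) ≠ 0 := fun h => by rw [h] at r1; simp at r1
  have n2 : (-(2 * I * z) - t) ≠ 0 := fun h => by rw [h] at r2; simp at r2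
  have i1 := integrableOn_exp_mul_complex_Ioi r1 0
  have i2 := integrableOn_exp_mul_complex_Ioi r2 0
  have e : (fun y : ℝ => 4 * Complex.sin (2 * y * z) * Complex.exp (-t * y)) =
      fun y : ℝ => 2 / I * (Complex.exp ((2 * I * z - t) * y) -
        Complex.exp ((-(2 * I * z) - t) * y)) := by
    funext y
    have h0 : Complex.sin (2 * y * z) =
      (Complex.exp (-(2 * y * z) * I) - Complex.exp (2 * y * z * I)) * I / 2 := rfl
    have a1 : (2 * I * z - t) * y = 2 * y * z * I + -t * y := by ring
    have a2 : (-(2 * I * z) - t) * y = -(2 * y * z) * I + -t * y := by ring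
    rw [h0, a1, a2, Complex.exp_add, Complex.exp_add, Complex.div_I]
    ring
  rw [e]
  refine ⟨(i1.sub i2).const_mul _, ?_⟩
  rw [integral_const_mul, integral_sub i1 i2, integral_exp_mul_complex_Ioi r1,
    integral_exp_mul_complex_Ioi r2]
  simp only [ofReal_zero, mul_zero, Complex.exp_zero]
  have n3 : (t - 2 * I * z) ≠ 0 := fun h => n1 (by linear_combination -h)
  have n4 : (t + 2 * I * z) ≠ 0 := fun h => n2 (by linear_combination -h)
  have m1 : (2 * I * z - t) = -(t - 2 * I * z) := by ring
  have m2 : (-(2 * I * z) - t) = -(t + 2 * I * z) := by ring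
  rw [m1, m2, neg_div_neg_eq, neg_div_neg_eq]

/-- A telescoping sum: the truncated expansion of `1 / sinh t`, with an explicit remainder. -/
lemma sum_exp_mul_sinh (t : ℂ) (N : ℕ) :
    (∑ k ∈ Finset.range N, Complex.exp (-((2 * k + 1) * t))) * (2 * Complex.sinh t) =
      1 - Complex.exp (-(2 * N * t)) := by
  induction N with
  | zero => simp
  | succ N ih =>
    rw [Finset.sum_range_succ, add_mul, ih, Complex.two_sinh, mul_sub, ← Complex.exp_add,
      ← Complex.exp_add]
    push_cast
    ring_nf

/-- Expanding `1 / sinh` geometrically and integrating term by term produces the partial fractions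
of the tangent at `w = iz/p`. -/
lemma integral_sin_div_sinh {p : ℝ} (hp : 0 < p) {z : ℂ} (hz : |z.im| < p / 2) :
    ∫ y in Set.Ioi (0 : ℝ), 2 * Complex.sin (2 * y * z) / Complex.sinh ((p : ℂ) * y) =
      Real.pi / p * Complex.tanh (Real.pi * z / p) := by
  have hp0 : (p : ℂ) ≠ 0 := by exact_mod_cast hp.ne'
  obtain ⟨bound, hb, h⟩ := exists_bound_sin_div_sinh hp ‖z‖ (η := |z.im|) (by linarith)
  have lim1 : Tendsto (fun N : ℕ => ∫ y in Set.Ioi (0 : ℝ),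
      ∑ k ∈ Finset.range N,
        4 * Complex.sin (2 * y * z) * Complex.exp (-(((2 * k + 1) * p : ℝ) : ℂ) * y)) atTop
      (𝓝 (∫ y in Set.Ioi (0 : ℝ), 2 * Complex.sin (2 * y * z) / Complex.sinh ((p : ℂ) * y))) := by
    -- A partial sum is the limit times `1 - exp (-2py)^N`, a number in `[0, 1]`, so the bound for
    -- the limit dominates every partial sum.
    have hform : ∀ N : ℕ, ∀ y : ℝ, 0 < y → ∑ k ∈ Finset.range N,
        4 * Complex.sin (2 * y * z) * Complex.exp (-(((2 * k + 1) * p : ℝ) : ℂ) * y) =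
        (2 * Complex.sin (2 * y * z) / Complex.sinh ((p : ℂ) * y)) *
          ((1 - Real.exp (-(2 * p * y)) ^ N : ℝ) : ℂ) := by
      intro N y hy
      have hs := sinh_ofReal_mul_ne_zero hp hy
      have key := sum_exp_mul_sinh (p * y) N
      have e1 : ((1 - Real.exp (-(2 * p * y)) ^ N : ℝ) : ℂ) =
          1 - Complex.exp (-(2 * N * (p * y))) := by
        push_cast
        rw [← Complex.exp_nat_mul]
        ring_nf
      rw [e1, ← key, ← Finset.mul_sum]
      have e2 : ∀ k : ℕ, -(((2 * k + 1) * p : ℝ) : ℂ) * y = -((2 * k + 1) * (p * y)) := by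
        intro k; push_cast; ring
      simp_rw [e2]
      generalize Complex.sinh ((p : ℂ) * y) = P at *
      generalize ∑ k ∈ Finset.range N, Complex.exp (-((2 * (k : ℂ) + 1) * (p * y))) = Q
      field_simp
      ring
    refine tendsto_integral_of_dominated_convergence bound ?_ hb ?_ ?_
    · intro N
      refine Continuous.aestronglyMeasurable ?_
      fun_prop
    · intro N
      filter_upwards [ae_restrict_mem measurableSet_Ioi] with y hy
      rw [hform N y hy, norm_mul]
      have hy' : 0 < y := hy
      have hE0 : 0 ≤ Real.exp (-(2 * p * y)) := (Real.exp_pos _).le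
      have hE1 : Real.exp (-(2 * p * y)) ≤ 1 := Real.exp_le_one_iff.2 (by
        have := mul_pos hp hy'; linarith)
      have f1 := pow_le_one₀ (n := N) hE0 hE1
      have f2 := pow_nonneg hE0 N
      rw [Complex.norm_of_nonneg (by linarith)]
      refine (mul_le_of_le_one_right (norm_nonneg _) (by linarith)).trans ?_
      exact h z le_rfl le_rfl y hy
    · filter_upwards [ae_restrict_mem measurableSet_Ioi] with y hy
      have hy' : 0 < y := hy
      have hE0 : 0 ≤ Real.exp (-(2 * p * y)) := (Real.exp_pos _).le
      have hE1 : Real.exp (-(2 * p * y)) < 1 := Real.exp_lt_one_iff.2 (by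
        have := mul_pos hp hy'; linarith)
      have f := (tendsto_pow_atTop_nhds_zero_of_lt_one hE0 hE1).const_sub 1
      have f2 := (Complex.continuous_ofReal.tendsto _).comp f
      have f3 := f2.const_mul (2 * Complex.sin (2 * y * z) / Complex.sinh ((p : ℂ) * y))
      simp only [sub_zero, ofReal_one, mul_one] at f3
      refine f3.congr fun N => (hform N y hy').symm
  have hint : ∀ k : ℕ, _ := fun k : ℕ =>
    integrableOn_sin_mul_exp (z := z) (t := (2 * k + 1) * p) (by
      have : (0 : ℝ) ≤ k := k.cast_nonneg
      nlinarith)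
  have hw : |(I * z / p).re| < 1 / 2 := by
    have : (I * z / p).re = -z.im / p := by
      rw [Complex.div_ofReal_re]; simp
    rw [this, abs_div, abs_neg, abs_of_pos hp, div_lt_iff₀ hp]
    linarith
  have lim2 := (tendsto_sum_tan hw).const_mul (1 / (I * p))
  have hval : ∀ N : ℕ, ∫ y in Set.Ioi (0 : ℝ), ∑ k ∈ Finset.range N,
        4 * Complex.sin (2 * y * z) * Complex.exp (-(((2 * k + 1) * p : ℝ) : ℂ) * y) =
      1 / (I * p) * ∑ k ∈ Finset.range N,
        (1 / ((k : ℂ) + 1 / 2 - I * z / p) - 1 / (k + 1 / 2 + I * z / p)) := by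
    intro N
    rw [integral_finsetSum _ fun k _ => (hint k).1, Finset.mul_sum]
    refine Finset.sum_congr rfl fun k _ => ?_
    rw [(hint k).2]
    push_cast
    have a1 : ((2 * k + 1) * p - 2 * I * z : ℂ) = 2 * p * (k + 1 / 2 - I * z / p) := by
      field_simp
    have a2 : ((2 * k + 1) * p + 2 * I * z : ℂ) = 2 * p * (k + 1 / 2 + I * z / p) := by
      field_simp
    rw [a1, a2]
    generalize (k : ℂ) + 1 / 2 - I * z / p = X
    generalize (k : ℂ) + 1 / 2 + I * z / p = Y
    rw [← one_div_mul_one_div _ X, ← one_div_mul_one_div _ Y]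
    field_simp
  simp_rw [hval] at lim1
  rw [tendsto_nhds_unique lim1 lim2]
  have e : (Real.pi : ℂ) * (I * z / p) = (Real.pi * z / p) * I := by ring
  rw [e, Complex.tan_mul_I]
  field_simp

/-- The function `z ↦ exp (∫ …)` equals `2 cosh (π z / p)` up to a constant factor. -/
lemma exp_integral_logCoshIntegrand_eq_mul {p : ℝ} (hp : 0 < p) {z : ℂ} (hz : |z.im| < p / 2) :
    Complex.exp (∫ y in Set.Ioi (0 : ℝ), logCoshIntegrand p z y) =
      Complex.exp (∫ y in Set.Ioi (0 : ℝ), logCoshIntegrand p 0 y) *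
        Complex.cosh (Real.pi * z / p) := by
  set S : Set ℂ := {z | |z.im| < p / 2} with hS
  have hSo : IsOpen S := isOpen_lt (continuous_abs.comp continuous_im) continuous_const
  have hSc : Convex ℝ S := by
    have : S = Complex.imLm ⁻¹' (Set.Ioo (-(p / 2)) (p / 2)) := by
      ext w
      simp [hS, abs_lt]
    rw [this]
    exact (convex_Ioo _ _).linear_preimage _
  -- Numerator and denominator have the same logarithmic derivative `(π/p) tanh (πz/p)`, so `F` is
  -- constant on the convex strip.
  set F : ℂ → ℂ := fun z => Complex.exp (∫ y in Set.Ioi (0 : ℝ), logCoshIntegrand p z y) /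
    Complex.cosh (Real.pi * z / p) with hF
  have hd : ∀ w ∈ S, HasDerivAt F 0 w := by
    intro w hw
    have hc := cosh_pi_mul_div_ne_zero hp hw
    have d1 := (hasDerivAt_integral_logCoshIntegrand hp hw).cexp
    have d2 : HasDerivAt (fun w : ℂ => Complex.cosh (Real.pi * w / p))
        (Complex.sinh (Real.pi * w / p) * (Real.pi * 1 / p)) w :=
      (((hasDerivAt_id w).const_mul (Real.pi : ℂ)).div_const (p : ℂ)).ccosh
    refine (d1.div d2 hc).congr_deriv ?_
    rw [integral_sin_div_sinh hp hw, Complex.tanh]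
    field_simp
    ring
  have h0 : (0 : ℂ) ∈ S := by simpa [hS] using hp
  have hconst := hSo.is_const_of_deriv_eq_zero hSc.isPreconnected
    (fun w hw => (hd w hw).differentiableAt.differentiableWithinAt)
    (fun w hw => (hd w hw).deriv) (show z ∈ S from hz) h0
  simp only [hF] at hconst
  rw [mul_zero, zero_div, Complex.cosh_zero, div_one,
    div_eq_iff (cosh_pi_mul_div_ne_zero hp hz)] at hconst
  exact hconst

/-- At `±ip/4` the cosine becomes `cosh (py/2)`, which cancels half of `sinh (py) = 2 sinh (py/2)
cosh (py/2)`; the sum is the integrand at `0` after the rescaling `y ↦ y/2`. This determines the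
constant left open by differentiation. -/
lemma integral_logCoshIntegrand_duplication {p : ℝ} (hp : 0 < p) :
    (∫ y in Set.Ioi (0 : ℝ), logCoshIntegrand p (I * p / 4) y) +
      (∫ y in Set.Ioi (0 : ℝ), logCoshIntegrand p (-(I * p / 4)) y) =
      ∫ y in Set.Ioi (0 : ℝ), logCoshIntegrand p 0 y := by
  have hp0 : (p : ℂ) ≠ 0 := by exact_mod_cast hp.ne'
  have him : (I * (p : ℂ) / 4).im = p / 4 := by simp
  rw [← integral_add (integrableOn_logCoshIntegrand hp (by
      rw [him, abs_of_pos (by positivity)]; linarith))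
    (integrableOn_logCoshIntegrand hp (by
      rw [neg_im, him, abs_neg, abs_of_pos (by positivity)]; linarith))]
  have hsc := integral_comp_mul_left_Ioi' (logCoshIntegrand p 0) 0 (b := 1 / 2) (by norm_num)
  rw [mul_zero] at hsc
  rw [← hsc, ← integral_smul]
  refine setIntegral_congr_fun measurableSet_Ioi fun y hy => ?_
  have hy' : 0 < y := hy
  have hy0 : (y : ℂ) ≠ 0 := by exact_mod_cast hy'.ne'
  have hs := sinh_ofReal_mul_ne_zero (p := p) (y := y / 2) hp (by positivity)
  have hs2 := sinh_ofReal_mul_ne_zero (p := p) (y := y) hp hy'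
  simp only [logCoshIntegrand, Complex.real_smul]
  have a1 : 2 * (y : ℂ) * (I * p / 4) = (p * (y / 2)) * I := by ring
  have a2 : 2 * (y : ℂ) * (-(I * p / 4)) = -((p * (y / 2)) * I) := by ring
  have a3 : Complex.sinh ((p : ℂ) * y) =
      2 * Complex.sinh (p * (y / 2)) * Complex.cosh (p * (y / 2)) := by
    rw [← Complex.sinh_two_mul]; ring_nf
  rw [a3] at hs2
  have hc : Complex.cosh (p * ((y : ℂ) / 2)) ≠ 0 := right_ne_zero_of_mul hs2
  push_cast at hs
  rw [a1, a2, Complex.cos_neg, Complex.cos_mul_I, a3]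
  push_cast
  rw [mul_zero, Complex.cos_zero, one_div_mul_eq_div (2 : ℂ) (y : ℂ)]
  generalize Complex.sinh (p * ((y : ℂ) / 2)) = P at *
  generalize Complex.cosh (p * ((y : ℂ) / 2)) = Q at *
  field_simp
  ring

lemma exp_integral_logCoshIntegrand {p : ℝ} (hp : 0 < p) {z : ℂ} (hz : |z.im| < p / 2) :
    Complex.exp (∫ y in Set.Ioi (0 : ℝ), logCoshIntegrand p z y) =
      2 * Complex.cosh (Real.pi * z / p) := by
  have hp0 : (p : ℂ) ≠ 0 := by exact_mod_cast hp.ne'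
  rw [exp_integral_logCoshIntegrand_eq_mul hp hz]
  congr 1
  have him : (I * (p : ℂ) / 4).im = p / 4 := by simp
  have h := congrArg Complex.exp (integral_logCoshIntegrand_duplication hp)
  rw [Complex.exp_add, exp_integral_logCoshIntegrand_eq_mul hp (z := I * p / 4) (by
      rw [him, abs_of_pos (by positivity)]; linarith),
    exp_integral_logCoshIntegrand_eq_mul hp (z := -(I * p / 4)) (by
      rw [neg_im, him, abs_neg, abs_of_pos (by positivity)]; linarith)] at h
  have a1 : (Real.pi : ℂ) * (I * p / 4) / p = ((Real.pi / 4 : ℝ) : ℂ) * I := by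
    push_cast; field_simp
  have a2 : (Real.pi : ℂ) * (-(I * p / 4)) / p = -(((Real.pi / 4 : ℝ) : ℂ) * I) := by
    push_cast; field_simp
  rw [a1, a2, Complex.cosh_neg, Complex.cosh_mul_I, ← Complex.ofReal_cos, Real.cos_pi_div_four] at h
  have hsq : ((√2 / 2 : ℝ) : ℂ) * ((√2 / 2 : ℝ) : ℂ) = 1 / 2 := by
    rw [← Complex.ofReal_mul]
    have : √2 / 2 * (√2 / 2) = (1 / 2 : ℝ) := by
      have := Real.mul_self_sqrt (show (0 : ℝ) ≤ 2 by norm_num)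
      linarith
    rw [this]; push_cast; rfl
  have hne := Complex.exp_ne_zero (∫ y in Set.Ioi (0 : ℝ), logCoshIntegrand p 0 y)
  generalize Complex.exp (∫ y in Set.Ioi (0 : ℝ), logCoshIntegrand p 0 y) = C at *
  -- Duplication reads `C² cos² (π/4) = C`; since `C` is an exponential it is nonzero, hence `C =
  -- 2`.
  have h' : C * (C - 2) = 0 := by linear_combination 2 * h - 2 * C ^ 2 * hsq
  rcases mul_eq_zero.1 h' with h' | h'
  · exact absurd h' hne
  · linear_combination h'

/-- The difference equation of `exp (i g)` inside the strip. -/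
lemma exp_integral_gIntegrand_shift {p q : ℝ} (hp : 0 < p) (hq : 0 < q) {z : ℂ}
    (hz : |z.im| < p / 2) :
    Complex.exp (I * ∫ y in Set.Ioi (0 : ℝ), gIntegrand p q (z + I * q / 2) y) =
      2 * Complex.cosh (Real.pi * z / p) *
        Complex.exp (I * ∫ y in Set.Ioi (0 : ℝ), gIntegrand p q (z - I * q / 2) y) := by
  have h : (∫ y in Set.Ioi (0 : ℝ), gIntegrand p q (z + I * q / 2) y) -
      (∫ y in Set.Ioi (0 : ℝ), gIntegrand p q (z - I * q / 2) y) =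
      -I * ∫ y in Set.Ioi (0 : ℝ), logCoshIntegrand p z y := by
    rw [← integral_sub (integrableOn_gIntegrand_add hp hq hz) (integrableOn_gIntegrand_sub hp hq hz),
      ← integral_const_mul]
    exact setIntegral_congr_fun measurableSet_Ioi fun y hy => gIntegrand_sub hp hq z hy
  rw [← exp_integral_logCoshIntegrand hp hz, ← Complex.exp_add]
  congr 1
  linear_combination I * h - (∫ y in Set.Ioi (0 : ℝ), logCoshIntegrand p z y) * I_sq

lemma gIntegrand_comm (p q : ℝ) : gIntegrand p q = gIntegrand q p := by
  funext z y
  unfold gIntegrand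
  ring_nf

/-! ### The two difference equations of `G` -/

/-- The pole set is closed under downward shifts; equivalently, regularity propagates upwards. -/
lemma IsGPole.sub_I_mul {a : ℤˣ → ℝ} {z : ℂ} (h : IsGPole a z) (δ : ℤˣ) :
    IsGPole a (z - I * a δ) := by
  obtain ⟨k, l, rfl⟩ := h
  rcases Int.units_eq_one_or δ with rfl | rfl
  · exact ⟨k + 1, l, by push_cast; ring⟩
  · exact ⟨k, l + 1, by push_cast; ring⟩

lemma IsGPole.im_le {a : ℤˣ → ℝ} (ha : ∀ δ, 0 < a δ) {z : ℂ} (h : IsGPole a z) :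
    z.im ≤ -((a 1 + a (-1)) / 2) := by
  obtain ⟨k, l, rfl⟩ := h
  have h1 : 0 ≤ (k : ℝ) * a 1 := mul_nonneg k.cast_nonneg (ha 1).le
  have h2 : 0 ≤ (l : ℝ) * a (-1) := mul_nonneg l.cast_nonneg (ha (-1)).le
  simp
  linarith

lemma c_eq_zero_iff {a : ℤˣ → ℝ} (ha : ∀ δ, 0 < a δ) (δ : ℤˣ) (z : ℂ) :
    c a δ z = 0 ↔ ∃ m : ℤ, z = I * (m + 1 / 2) * a δ :=
  cosh_pi_mul_div_eq_zero_iff (ha δ) z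

lemma c_add_I_mul {a : ℤˣ → ℝ} (ha : ∀ δ, 0 < a δ) (δ : ℤˣ) (z : ℂ) :
    c a δ (z + I * a δ) = -c a δ z := by
  have hp0 : (a δ : ℂ) ≠ 0 := by exact_mod_cast (ha δ).ne'
  unfold c
  have e : (Real.pi : ℂ) * (z + I * a δ) / a δ = Real.pi * z / a δ + Real.pi * I := by
    field_simp
  rw [e, Complex.cosh_add, Complex.cosh_mul_I, Complex.sinh_mul_I]
  simp

lemma level_add_I_mul {a : ℤˣ → ℝ} (ha : ∀ δ, 0 < a δ) (w : ℂ) :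
    level a (w + I * a 1) = level a w + 1 := by
  unfold level
  have : (w + I * a 1).im / a 1 = w.im / a 1 + 1 := by
    have := (ha 1).ne'
    simp
    field_simp
  rw [this, round_add_one]

lemma level_bounds {a : ℤˣ → ℝ} (ha : ∀ δ, 0 < a δ) (w : ℂ) :
    (level a w - 1 / 2) * a 1 ≤ w.im ∧ w.im < (level a w + 1 / 2) * a 1 := by
  have h1 := Int.floor_le (w.im / a 1 + 1 / 2)
  have h2 := Int.lt_floor_add_one (w.im / a 1 + 1 / 2)
  rw [← round_eq] at h1 h2
  change (level a w : ℝ) ≤ _ at h1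
  change _ < (level a w : ℝ) + 1 at h2
  constructor
  · rw [← le_div_iff₀ (ha 1)]; linarith
  · rw [← div_lt_iff₀ (ha 1)]; linarith

/-- The shift raises `level` by exactly one, so the exponential is unchanged and one product gains
or loses a single factor. At negative level the factor leaves the denominator, and must therefore be
nonzero. -/
lemma G_add_I_mul_one {a : ℤˣ → ℝ} (ha : ∀ δ, 0 < a δ) {w : ℂ} (hw : ¬ IsGPole a w) :
    G a (w + I * a 1) = 2 * c a (-1) (w + I * a 1 / 2) * G a w := by
  unfold G
  rw [level_add_I_mul ha]
  have hb := level_bounds ha w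
  generalize hN : level a w = N at hb
  have e : w + I * a 1 - I * ((N + 1 : ℤ) : ℂ) * a 1 = w - I * (N : ℂ) * a 1 := by
    push_cast; ring
  rw [e, ← mul_assoc]
  congr 1
  rcases N with n | n
  · have t1 : (Int.ofNat n + 1).toNat = n + 1 := by simp
    have t2 : (Int.ofNat n).toNat = n := rfl
    have t3 : (-(Int.ofNat n + 1)).toNat = 0 := by simp
    have t4 : (-(Int.ofNat n)).toNat = 0 := by simp
    rw [t1, t2, t3, t4, Finset.prod_range_succ']
    simp only [Finset.range_zero, Finset.prod_empty, div_one]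
    rw [mul_comm]
    congr 1
    · congr 2; push_cast; ring
    · refine Finset.prod_congr rfl fun j _ => ?_
      congr 2; push_cast; ring
  · have t1 : (Int.negSucc n + 1).toNat = 0 := by omega
    have t2 : (Int.negSucc n).toNat = 0 := by omega
    have t3 : (-(Int.negSucc n + 1)).toNat = n := by omega
    have t4 : (-(Int.negSucc n)).toNat = n + 1 := by omega
    rw [t1, t2, t3, t4, Finset.prod_range_succ']
    simp only [Finset.range_zero, Finset.prod_empty]
    -- At negative level `Im w < -a₊/2`, so a zero of the cosine here has `m < 0`, and `w` is then
    -- the pole with `k = 0`, `l = -m - 1`.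
    have hc : c a (-1) (w + I * a 1 / 2) ≠ 0 := by
      rw [Ne, c_eq_zero_iff ha]
      rintro ⟨m, hm⟩
      have him := congrArg Complex.im hm
      simp at him
      have hn : (0 : ℝ) ≤ n := n.cast_nonneg
      have h1 := hb.2
      push_cast [Int.negSucc_eq] at h1
      have h2 : ((m : ℝ) + 1 / 2) * a (-1) < 0 := by
        have := mul_nonneg hn (ha 1).le
        norm_num at him ⊢
        linarith
      have h3 : (m : ℝ) < 0 := by
        have := (ha (-1))
        by_contra hcon
        push Not at hcon
        nlinarith
      have h4 : m < 0 := by exact_mod_cast h3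
      obtain ⟨l, hl⟩ := Int.eq_ofNat_of_zero_le (show 0 ≤ -m - 1 by omega)
      refine hw ⟨0, l, ?_⟩
      have hl' : (m : ℂ) = -l - 1 := by
        have : m = -l - 1 := by omega
        rw [this]; push_cast; ring
      rw [hl'] at hm
      push_cast
      linear_combination hm
    have f0 : w + I * (((0 : ℕ) : ℂ) + 1 / 2) * a 1 = w + I * a 1 / 2 := by push_cast; ring
    have fj : ∀ j : ℕ, w + I * (((j + 1 : ℕ) : ℂ) + 1 / 2) * a 1 =
        w + I * a 1 + I * ((j : ℂ) + 1 / 2) * a 1 := by intro j; push_cast; ring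
    simp_rw [fj]
    rw [f0]
    generalize ∏ j ∈ Finset.range n, 2 * c a (-1) (w + I * a 1 + I * ((j : ℂ) + 1 / 2) * a 1) = Q
    generalize c a (-1) (w + I * a 1 / 2) = C at hc
    field_simp

lemma not_isGPole_of_abs_im_lt {a : ℤˣ → ℝ} (ha : ∀ δ, 0 < a δ) {z : ℂ}
    (hz : |z.im| < (a 1 + a (-1)) / 2) : ¬ IsGPole a z := fun h => by
  have := h.im_le ha
  have := abs_lt.1 hz
  linarith

lemma exp_g_add_I_mul {a : ℤˣ → ℝ} (ha : ∀ δ, 0 < a δ) (δ : ℤˣ) {w : ℂ}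
    (hw : |w.im + a (-δ) / 2| < a δ / 2) :
    Complex.exp (I * g a (w + I * a (-δ))) =
      2 * c a δ (w + I * a (-δ) / 2) * Complex.exp (I * g a w) := by
  have h := exp_integral_gIntegrand_shift (ha δ) (ha (-δ)) (z := w + I * a (-δ) / 2) (by
    simpa using hw)
  have e1 : w + I * a (-δ) / 2 + I * a (-δ) / 2 = w + I * a (-δ) := by ring
  have e2 : w + I * a (-δ) / 2 - I * a (-δ) / 2 = w := by ring
  rw [e1, e2] at h
  have hg : ∀ z, g a z = ∫ y in Set.Ioi (0 : ℝ), gIntegrand (a δ) (a (-δ)) z y := by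
    intro z
    rcases Int.units_eq_one_or δ with rfl | rfl
    · rfl
    · rw [neg_neg, gIntegrand_comm]; rfl
  rw [hg, hg]
  exact h

/-- In the strip of convergence, `G` is given by the integral representation. -/
lemma G_eq_exp_g {a : ℤˣ → ℝ} (ha : ∀ δ, 0 < a δ) {z : ℂ}
    (hz : |z.im| < (a 1 + a (-1)) / 2) : G a z = Complex.exp (I * g a z) := by
  have h1 := ha 1
  have h2 := ha (-1)
  suffices H : ∀ N : ℤ, ∀ z : ℂ, level a z = N → |z.im| < (a 1 + a (-1)) / 2 →
      G a z = Complex.exp (I * g a z) from H _ z rfl hz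
  have hshift : ∀ w : ℂ, |w.im + a 1 / 2| < a (-1) / 2 →
      Complex.exp (I * g a (w + I * a 1)) =
        2 * c a (-1) (w + I * a 1 / 2) * Complex.exp (I * g a w) := by
    intro w hw
    have := exp_g_add_I_mul ha (-1) (w := w) (by rwa [neg_neg])
    rwa [neg_neg] at this
  -- Both sides agree at level `0` and obey the same `a₊`-equation inside the strip; going down, the
  -- cosine factor is nonzero and can be cancelled.
  intro N
  induction N using Int.induction_on with
  | zero =>
    intro z hN _
    simp [G, hN]
  | succ n ih =>
    intro z hN hz
    have hb := level_bounds ha z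
    rw [hN] at hb
    push_cast at hb
    have hn : (0 : ℝ) ≤ n * a 1 := mul_nonneg n.cast_nonneg h1.le
    have hz' := abs_lt.1 hz
    obtain ⟨w, rfl⟩ : ∃ w, z = w + I * a 1 := ⟨z - I * a 1, by ring⟩
    have him : (w + I * a 1).im = w.im + a 1 := by simp
    rw [him] at hb hz'
    rw [level_add_I_mul ha] at hN
    have hwz : |w.im| < (a 1 + a (-1)) / 2 := by
      rw [abs_lt]; constructor <;> linarith
    rw [G_add_I_mul_one ha (not_isGPole_of_abs_im_lt ha hwz), ih w (by omega) hwz, hshift]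
    rw [abs_lt]; constructor <;> linarith
  | pred n ih =>
    intro z hN hz
    have hb := level_bounds ha z
    rw [hN] at hb
    push_cast at hb
    have hn : (0 : ℝ) ≤ n * a 1 := mul_nonneg n.cast_nonneg h1.le
    have hz' := abs_lt.1 hz
    have him : (z + I * a 1).im = z.im + a 1 := by simp
    have hs : |z.im + a 1 / 2| < a (-1) / 2 := by
      rw [abs_lt]; constructor <;> linarith
    have hG := G_add_I_mul_one ha (not_isGPole_of_abs_im_lt ha hz)
    rw [ih (z + I * a 1) (by rw [level_add_I_mul ha]; omega) (by
      rw [him, abs_lt]; constructor <;> linarith), hshift z hs] at hG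
    have hc : c a (-1) (z + I * a 1 / 2) ≠ 0 :=
      cosh_pi_mul_div_ne_zero h2 (by simpa using hs)
    exact (mul_left_cancel₀ (mul_ne_zero two_ne_zero hc) hG).symm

lemma continuousAt_g {a : ℤˣ → ℝ} (ha : ∀ δ, 0 < a δ) {z : ℂ}
    (hz : |z.im| < (a 1 + a (-1)) / 2) : ContinuousAt (g a) z :=
  continuousAt_integral_gIntegrand (ha 1) (ha (-1)) hz

lemma continuous_c (a : ℤˣ → ℝ) (δ : ℤˣ) : Continuous (c a δ) := by
  unfold c
  fun_prop

lemma G_add_I_mul_neg_one_of_abs_lt {a : ℤˣ → ℝ} (ha : ∀ δ, 0 < a δ) {w : ℂ}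
    (hw : |w.im + a (-1) / 2| < a 1 / 2) :
    G a (w + I * a (-1)) = 2 * c a 1 (w + I * a (-1) / 2) * G a w := by
  have h1 := ha 1
  have h2 := ha (-1)
  have hw' := abs_lt.1 hw
  rw [G_eq_exp_g ha (z := w), G_eq_exp_g ha (z := w + I * a (-1)), exp_g_add_I_mul ha 1 hw]
  · simp only [add_im, mul_im, I_re, I_im, ofReal_im, ofReal_re]
    rw [abs_lt]; constructor <;> linarith
  · rw [abs_lt]; constructor <;> linarith

/-- Here `w + i a₋` lies on the edge of the strip of convergence. The `a₊`-equation moves it back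
inside, so the defect of the equation becomes the continuous function `Φ`, which vanishes just below
the edge. Including this edge yields a half-open strip whose `a₊`-translates tile the plane. -/
lemma G_add_I_mul_neg_one_of_eq {a : ℤˣ → ℝ} (ha : ∀ δ, 0 < a δ) {w : ℂ}
    (hw : w.im + a (-1) / 2 = a 1 / 2) :
    G a (w + I * a (-1)) = 2 * c a 1 (w + I * a (-1) / 2) * G a w := by
  have h1 := ha 1
  have h2 := ha (-1)
  set Φ : ℂ → ℂ := fun w =>
    2 * c a (-1) (w + I * a (-1) - I * a 1 + I * a 1 / 2) *
      Complex.exp (I * g a (w + I * a (-1) - I * a 1)) -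
    2 * c a 1 (w + I * a (-1) / 2) * Complex.exp (I * g a w) with hΦ
  have hΦG : ∀ w : ℂ, |w.im| < (a 1 + a (-1)) / 2 → |w.im + a (-1) - a 1| < (a 1 + a (-1)) / 2 →
      Φ w = G a (w + I * a (-1)) - 2 * c a 1 (w + I * a (-1) / 2) * G a w := by
    intro w k1 k2
    have k3 : |(w + I * a (-1) - I * a 1).im| < (a 1 + a (-1)) / 2 := by simpa using k2
    have k4 := G_add_I_mul_one ha (not_isGPole_of_abs_im_lt ha k3)
    rw [sub_add_cancel] at k4
    simp only [hΦ]
    rw [k4, G_eq_exp_g ha k1, G_eq_exp_g ha k3]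
  have b1 : |w.im| < (a 1 + a (-1)) / 2 := by
    rw [abs_lt]; constructor <;> linarith
  have b2 : |w.im + a (-1) - a 1| < (a 1 + a (-1)) / 2 := by
    rw [abs_lt]; constructor <;> linarith
  have hcont : ContinuousAt Φ w := by
    have c1 := continuousAt_g ha b1
    have c2 : ContinuousAt (fun w : ℂ => g a (w + I * a (-1) - I * a 1)) w := by
      refine ContinuousAt.comp (f := fun w : ℂ => w + I * a (-1) - I * a 1) (g := g a)
        (continuousAt_g ha (by simpa using b2)) (by fun_prop)
    have c3 := continuous_c a 1
    have c4 := continuous_c a (-1)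
    have c5 : ContinuousAt (fun w : ℂ => c a (-1) (w + I * a (-1) - I * a 1 + I * a 1 / 2)) w :=
      (c4.comp (by fun_prop)).continuousAt
    have c6 : ContinuousAt (fun w : ℂ => c a 1 (w + I * a (-1) / 2)) w :=
      (c3.comp (by fun_prop)).continuousAt
    exact ((continuousAt_const.mul c5).mul (continuousAt_const.mul c2).cexp).sub
      ((continuousAt_const.mul c6).mul (continuousAt_const.mul c1).cexp)
  have hlim : Tendsto (fun t : ℝ => Φ (w - I * t)) (𝓝[>] 0) (𝓝 (Φ w)) := by
    have h0 : Tendsto (fun t : ℝ => w - I * t) (𝓝[>] 0) (𝓝 w) := by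
      have : Continuous (fun t : ℝ => w - I * t) := by fun_prop
      have h := (this.tendsto 0).mono_left (nhdsWithin_le_nhds (s := Set.Ioi 0))
      simpa using h
    exact hcont.tendsto.comp h0
  have hzero : ∀ᶠ t : ℝ in 𝓝[>] 0, Φ (w - I * t) = 0 := by
    filter_upwards [Ioo_mem_nhdsGT (lt_min h1 h2)] with t ht
    have t1 := ht.2.trans_le (min_le_left _ _)
    have t2 := ht.2.trans_le (min_le_right _ _)
    have t0 := ht.1
    have him : (w - I * t).im = w.im - t := by simp
    rw [hΦG, G_add_I_mul_neg_one_of_abs_lt ha, sub_self]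
    all_goals rw [him, abs_lt]; constructor <;> linarith
  have hlim0 : Tendsto (fun t : ℝ => Φ (w - I * t)) (𝓝[>] 0) (𝓝 0) :=
    tendsto_const_nhds.congr' (hzero.mono fun t ht => ht.symm)
  have := tendsto_nhds_unique hlim hlim0
  rw [hΦG w b1 b2] at this
  exact sub_eq_zero.1 this

lemma G_add_I_mul_neg_one {a : ℤˣ → ℝ} (ha : ∀ δ, 0 < a δ) {w : ℂ} (hw : ¬ IsGPole a w) :
    G a (w + I * a (-1)) = 2 * c a 1 (w + I * a (-1) / 2) * G a w := by
  have h1 := ha 1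
  have h2 := ha (-1)
  suffices H : ∀ N : ℤ, ∀ w : ℂ, (N - 1 / 2) * a 1 < w.im + a (-1) / 2 →
      w.im + a (-1) / 2 ≤ (N + 1 / 2) * a 1 → ¬ IsGPole a w →
      G a (w + I * a (-1)) = 2 * c a 1 (w + I * a (-1) / 2) * G a w by
    refine H ⌈(w.im + a (-1) / 2) / a 1 - 1 / 2⌉ w ?_ ?_ hw
    · rw [← lt_div_iff₀ h1]
      linarith [Int.ceil_lt_add_one ((w.im + a (-1) / 2) / a 1 - 1 / 2)]
    · rw [← div_le_iff₀ h1]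
      linarith [Int.le_ceil ((w.im + a (-1) / 2) / a 1 - 1 / 2)]
  -- The defect of the `a₋`-equation is multiplied by a cosine factor under `w ↦ w + i a₊`: the
  -- signs from the antiperiodicity of `c₊` and of `c₋` cancel.
  have step : ∀ w : ℂ, ¬ IsGPole a w → ¬ IsGPole a (w + I * a (-1)) →
      G a (w + I * a 1 + I * a (-1)) -
          2 * c a 1 (w + I * a 1 + I * a (-1) / 2) * G a (w + I * a 1) =
        2 * c a (-1) (w + I * a (-1) + I * a 1 / 2) *
          (G a (w + I * a (-1)) - 2 * c a 1 (w + I * a (-1) / 2) * G a w) := by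
    intro w k1 k2
    have e1 : w + I * a 1 + I * a (-1) = w + I * a (-1) + I * a 1 := by ring
    have e2 : w + I * a 1 + I * a (-1) / 2 = w + I * a (-1) / 2 + I * a 1 := by ring
    have e3 : w + I * a (-1) + I * a 1 / 2 = w + I * a 1 / 2 + I * a (-1) := by ring
    rw [e1, e2, G_add_I_mul_one ha k1, G_add_I_mul_one ha k2, c_add_I_mul ha 1, e3,
      c_add_I_mul ha (-1)]
    ring
  have hup : ∀ w : ℂ, ¬ IsGPole a w → ¬ IsGPole a (w + I * a (-1)) := by
    intro w k k'
    have := k'.sub_I_mul (-1)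
    rw [add_sub_cancel_right] at this
    exact k this
  intro N
  induction N using Int.induction_on with
  | zero =>
    intro w k1 k2 _
    rcases k2.lt_or_eq with k2 | k2
    · apply G_add_I_mul_neg_one_of_abs_lt ha
      push_cast at k1 k2
      rw [abs_lt]; constructor <;> linarith
    · apply G_add_I_mul_neg_one_of_eq ha
      push_cast at k2
      linarith
  | succ n ih =>
    intro z k1 k2 _
    obtain ⟨w, rfl⟩ : ∃ w, z = w + I * a 1 := ⟨z - I * a 1, by ring⟩
    have him : (w + I * a 1).im = w.im + a 1 := by simp
    rw [him] at k1 k2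
    push_cast at k1 k2
    have hn : (0 : ℝ) ≤ n * a 1 := mul_nonneg n.cast_nonneg h1.le
    have hp : ¬ IsGPole a w := fun h => by
      have := h.im_le ha
      linarith
    have := step w hp (hup w hp)
    rw [ih w (by push_cast; linarith) (by push_cast; linarith) hp, sub_self, mul_zero] at this
    exact sub_eq_zero.1 this
  | pred n ih =>
    intro w k1 k2 hp
    have him : (w + I * a 1).im = w.im + a 1 := by simp
    push_cast at k1 k2
    have hn : (0 : ℝ) ≤ n * a 1 := mul_nonneg n.cast_nonneg h1.le
    have hp' : ¬ IsGPole a (w + I * a 1) := fun h => hp (by simpa using h.sub_I_mul 1)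
    have h := step w hp (hup w hp)
    rw [ih (w + I * a 1) (by rw [him]; push_cast; linarith) (by rw [him]; push_cast; linarith) hp',
      sub_self] at h
    -- Descending requires division by this factor; if it vanished, `w` would be the pole with `k =
    -- 0`, `l = -m`.
    have hc : c a (-1) (w + I * a (-1) + I * a 1 / 2) ≠ 0 := by
      rw [Ne, c_eq_zero_iff ha]
      rintro ⟨m, hm⟩
      have him := congrArg Complex.im hm
      simp at him
      have h3 : (m : ℝ) * a (-1) ≤ 0 := by norm_num at him; linarith
      have h4 : (m : ℝ) ≤ 0 := nonpos_of_mul_nonpos_left h3 h2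
      have h5 : m ≤ 0 := by exact_mod_cast h4
      obtain ⟨l, hl⟩ := Int.eq_ofNat_of_zero_le (show 0 ≤ -m by omega)
      refine hp ⟨0, l, ?_⟩
      have hl' : (m : ℂ) = -l := by
        have : m = -l := by omega
        rw [this]; push_cast; ring
      rw [hl'] at hm
      push_cast
      linear_combination hm
    rcases mul_eq_zero.1 h.symm with h | h
    · exact absurd h (mul_ne_zero two_ne_zero hc)
    · exact sub_eq_zero.1 h

/-- The difference equations of the hyperbolic gamma function. -/
lemma G_add_I_mul {a : ℤˣ → ℝ} (ha : ∀ δ, 0 < a δ) (δ : ℤˣ) {w : ℂ} (hw : ¬ IsGPole a w) :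
    G a (w + I * a (-δ)) = 2 * c a δ (w + I * a (-δ) / 2) * G a w := by
  rcases Int.units_eq_one_or δ with rfl | rfl
  · exact G_add_I_mul_neg_one ha hw
  · simpa using G_add_I_mul_one ha hw

/-! ### Hyperbolic identities with symmetric right-hand sides -/

lemma two_cosh_mul_two_cosh (x y : ℂ) :
    2 * Complex.cosh x * (2 * Complex.cosh y) =
      2 * (Complex.cosh (x + y) + Complex.cosh (x - y)) := by
  rw [Complex.cosh_add, Complex.cosh_sub]
  ring

/-- The cofactor of `sinh X` is invariant under `X ↔ V` together with `D ↔ B - D`, which gives the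
first identity. -/
lemma sinh_mul_cosh_add_cosh (X B D V : ℂ) :
    Complex.sinh (X - B + D) * (Complex.cosh (X + B) + Complex.cosh V) +
        Complex.sinh (X + B - D) * (Complex.cosh (X - B) + Complex.cosh V) =
      Complex.sinh X *
        (2 * Complex.cosh V * Complex.cosh (B - D) + 2 * Complex.cosh X * Complex.cosh D) := by
  have hX := Complex.exp_ne_zero X
  have hB := Complex.exp_ne_zero B
  have hD := Complex.exp_ne_zero D
  simp only [Complex.sinh, Complex.cosh, neg_add, sub_eq_add_neg, Complex.exp_add, neg_neg,
    Complex.exp_neg]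
  generalize Complex.exp X = x at *
  generalize Complex.exp B = b at *
  generalize Complex.exp D = d at *
  field_simp
  ring

/-- The cofactor of `sinh X` is symmetric in `X` and `V` for every `κ`, so nothing about `κ` is
needed for the second identity. -/
lemma sinh_mul_cosh_add_const_mul (X B V κ : ℂ) :
    Complex.sinh (X - B) *
          ((Complex.cosh (X - V + B) + κ) * (Complex.cosh (X + V + B) + κ)) +
        Complex.sinh (X + B) *
          ((Complex.cosh (X + V - B) + κ) * (Complex.cosh (X - V - B) + κ)) =
      Complex.sinh X * (2 * κ ^ 2 * Complex.cosh B + 4 * κ * Complex.cosh X * Complex.cosh V +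
        Complex.cosh B * (Complex.cosh (2 * X) + Complex.cosh (2 * V)) +
        (Complex.cosh B - Complex.cosh (3 * B)) / 2) := by
  have hX := Complex.exp_ne_zero X
  have hB := Complex.exp_ne_zero B
  have hV := Complex.exp_ne_zero V
  have e2 : ∀ Y : ℂ, Complex.exp (2 * Y) = Complex.exp Y ^ 2 := fun Y => by
    rw [← Complex.exp_nat_mul]; norm_num
  have e3 : ∀ Y : ℂ, Complex.exp (3 * Y) = Complex.exp Y ^ 3 := fun Y => by
    rw [← Complex.exp_nat_mul]; norm_num
  simp only [Complex.sinh, Complex.cosh, neg_add, sub_eq_add_neg, Complex.exp_add, neg_neg,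
    Complex.exp_neg, e2, e3]
  generalize Complex.exp X = x at *
  generalize Complex.exp B = b at *
  generalize Complex.exp V = v at *
  field_simp
  ring

/-- Again the cofactor is symmetric in `X` and `V`. The variables stand for half the usual ones, as
the third identity demands. -/
lemma sinh_half_mul_cosh_add_cosh (X B V : ℂ) :
    Complex.sinh (X - B) * (Complex.cosh (2 * X + 2 * B) + Complex.cosh (2 * V)) +
        Complex.sinh (X + B) * (Complex.cosh (2 * X - 2 * B) + Complex.cosh (2 * V)) =
      Complex.sinh X * (2 * Complex.cosh B * (Complex.cosh (2 * X) + Complex.cosh (2 * V)) +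
        Complex.cosh B - Complex.cosh (3 * B)) := by
  have hX := Complex.exp_ne_zero X
  have hB := Complex.exp_ne_zero B
  have hV := Complex.exp_ne_zero V
  have e2 : ∀ Y : ℂ, Complex.exp (2 * Y) = Complex.exp Y ^ 2 := fun Y => by
    rw [← Complex.exp_nat_mul]; norm_num
  have e3 : ∀ Y : ℂ, Complex.exp (3 * Y) = Complex.exp Y ^ 3 := fun Y => by
    rw [← Complex.exp_nat_mul]; norm_num
  simp only [Complex.sinh, Complex.cosh, neg_add, sub_eq_add_neg, Complex.exp_add, neg_neg,
    Complex.exp_neg, e2, e3]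
  generalize Complex.exp X = x at *
  generalize Complex.exp B = b at *
  generalize Complex.exp V = v at *
  field_simp
  ring

/-! ### Shifts of the kernel function -/

lemma K_eq (a : ℤˣ → ℝ) (b x v : ℂ) :
    K a b x v = G a ((x + v - I * b) / 2) * G a ((x - v - I * b) / 2) *
      (G a ((-x + v - I * b) / 2) * G a ((-x - v - I * b) / 2)) := by
  have hu : (Finset.univ : Finset ℤˣ) = {1, -1} := by decide
  have h1 : (1 : ℤˣ) ∉ ({-1} : Finset ℤˣ) := by decide
  simp only [K, hu, Finset.prod_insert h1, Finset.prod_singleton, kernelArg]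
  push_cast
  ring_nf

/-- The values of the kernel function at the four points shifted by `t`, in terms of its
factors at the lowest arguments. -/
lemma K_shift {a : ℤˣ → ℝ} {b x v t : ℂ} {P : ℂ → ℂ}
    (hx : KRegular a b (x - t) v) (hx' : KRegular a b (x + t) v)
    (hP : ∀ w, ¬ IsGPole a (w - t / 2) → G a (w + t / 2) = P w * G a (w - t / 2)) :
    ∃ M : ℂ,
      K a b (x - t) v = P ((-x + v - I * b) / 2) * P ((-x - v - I * b) / 2) * M ∧
      K a b (x + t) v = P ((x + v - I * b) / 2) * P ((x - v - I * b) / 2) * M ∧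
      K a b x (v - t) = P ((x - v - I * b) / 2) * P ((-x - v - I * b) / 2) * M ∧
      K a b x (v + t) = P ((x + v - I * b) / 2) * P ((-x + v - I * b) / 2) * M := by
  -- The lowered arguments with `+x` occur in `K` at `x - t`, those with `-x` in `K` at `x + t`; so
  -- these two points control all four.
  have r1 : ¬ IsGPole a ((x + v - I * b) / 2 - t / 2) := by
    convert hx 1 1 using 2; simp [kernelArg]; ring
  have r2 : ¬ IsGPole a ((x - v - I * b) / 2 - t / 2) := by
    convert hx 1 (-1) using 2; simp [kernelArg]; ring
  have r3 : ¬ IsGPole a ((-x + v - I * b) / 2 - t / 2) := by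
    convert hx' (-1) 1 using 2; simp [kernelArg]; ring
  have r4 : ¬ IsGPole a ((-x - v - I * b) / 2 - t / 2) := by
    convert hx' (-1) (-1) using 2; simp [kernelArg]; ring
  have g1 := hP _ r1
  have g2 := hP _ r2
  have g3 := hP _ r3
  have g4 := hP _ r4
  set w1 := (x + v - I * b) / 2 with hw1
  set w2 := (x - v - I * b) / 2 with hw2
  set w3 := (-x + v - I * b) / 2 with hw3
  set w4 := (-x - v - I * b) / 2 with hw4
  refine ⟨G a (w1 - t / 2) * G a (w2 - t / 2) * (G a (w3 - t / 2) * G a (w4 - t / 2)),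
    ?_, ?_, ?_, ?_⟩
  · rw [K_eq, show (x - t + v - I * b) / 2 = w1 - t / 2 by rw [hw1]; ring,
      show (x - t - v - I * b) / 2 = w2 - t / 2 by rw [hw2]; ring,
      show (-(x - t) + v - I * b) / 2 = w3 + t / 2 by rw [hw3]; ring,
      show (-(x - t) - v - I * b) / 2 = w4 + t / 2 by rw [hw4]; ring, g3, g4]
    ring
  · rw [K_eq, show (x + t + v - I * b) / 2 = w1 + t / 2 by rw [hw1]; ring,
      show (x + t - v - I * b) / 2 = w2 + t / 2 by rw [hw2]; ring,
      show (-(x + t) + v - I * b) / 2 = w3 - t / 2 by rw [hw3]; ring,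
      show (-(x + t) - v - I * b) / 2 = w4 - t / 2 by rw [hw4]; ring, g1, g2]
    ring
  · rw [K_eq, show (x + (v - t) - I * b) / 2 = w1 - t / 2 by rw [hw1]; ring,
      show (x - (v - t) - I * b) / 2 = w2 + t / 2 by rw [hw2]; ring,
      show (-x + (v - t) - I * b) / 2 = w3 - t / 2 by rw [hw3]; ring,
      show (-x - (v - t) - I * b) / 2 = w4 + t / 2 by rw [hw4]; ring, g2, g4]
    ring
  · rw [K_eq, show (x + (v + t) - I * b) / 2 = w1 + t / 2 by rw [hw1]; ring,
      show (x - (v + t) - I * b) / 2 = w2 - t / 2 by rw [hw2]; ring,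
      show (-x + (v + t) - I * b) / 2 = w3 + t / 2 by rw [hw3]; ring,
      show (-x - (v + t) - I * b) / 2 = w4 - t / 2 by rw [hw4]; ring, g1, g3]
    ring

/-- Product-to-sum turns the two cosine factors into a sum of two. `M` is fixed before `X`, `V`,
`B`, which enter through equations so that they can also be supplied as doubled halves. -/
lemma K_single_shift {a : ℤˣ → ℝ} (ha : ∀ δ, 0 < a δ) (δ : ℤˣ) {b x v : ℂ}
    (hx : KRegular a b (x - I * a (-δ)) v) (hx' : KRegular a b (x + I * a (-δ)) v) :
    ∃ M : ℂ, ∀ X V B : ℂ, X = Real.pi * x / a δ → V = Real.pi * v / a δ →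
      B = Real.pi * (I * b) / a δ →
      K a b (x - I * a (-δ)) v = (Complex.cosh (X + B) + Complex.cosh V) * M ∧
      K a b (x + I * a (-δ)) v = (Complex.cosh (X - B) + Complex.cosh V) * M ∧
      K a b x (v - I * a (-δ)) = (Complex.cosh (V + B) + Complex.cosh X) * M ∧
      K a b x (v + I * a (-δ)) = (Complex.cosh (V - B) + Complex.cosh X) * M := by
  obtain ⟨M, k1, k2, k3, k4⟩ := K_shift (P := fun w => 2 * c a δ w) hx hx' (fun w hw => by
    have h := G_add_I_mul ha δ hw
    rwa [sub_add_cancel, show w - I * a (-δ) / 2 + I * a (-δ) = w + I * a (-δ) / 2 by ring] at h)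
  refine ⟨2 * M, ?_⟩
  rintro X V B hX hV hB
  simp only [c, two_cosh_mul_two_cosh] at k1 k2 k3 k4
  have e1 : (Real.pi : ℂ) * ((x + v - I * b) / 2) / a δ = (X + V - B) / 2 := by
    rw [hX, hV, hB]; ring
  have e2 : (Real.pi : ℂ) * ((x - v - I * b) / 2) / a δ = (X - V - B) / 2 := by
    rw [hX, hV, hB]; ring
  have e3 : (Real.pi : ℂ) * ((-x + v - I * b) / 2) / a δ = (-X + V - B) / 2 := by
    rw [hX, hV, hB]; ring
  have e4 : (Real.pi : ℂ) * ((-x - v - I * b) / 2) / a δ = (-X - V - B) / 2 := by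
    rw [hX, hV, hB]; ring
  rw [e1, e2] at k2
  rw [e3, e4] at k1
  rw [e2, e4] at k3
  rw [e1, e3] at k4
  refine ⟨?_, ?_, ?_, ?_⟩
  · rw [k1, show (-X + V - B) / 2 + (-X - V - B) / 2 = -(X + B) by ring,
      show (-X + V - B) / 2 - (-X - V - B) / 2 = V by ring, Complex.cosh_neg]
    ring
  · rw [k2, show (X + V - B) / 2 + (X - V - B) / 2 = X - B by ring,
      show (X + V - B) / 2 - (X - V - B) / 2 = V by ring]
    ring
  · rw [k3, show (X - V - B) / 2 + (-X - V - B) / 2 = -(V + B) by ring,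
      show (X - V - B) / 2 - (-X - V - B) / 2 = X by ring, Complex.cosh_neg]
    ring
  · rw [k4, show (X + V - B) / 2 + (-X + V - B) / 2 = V - B by ring,
      show (X + V - B) / 2 - (-X + V - B) / 2 = X by ring]
    ring

/-- Applying the difference equation twice gives two cosines at `w ∓ i a_{-δ}/2`; their product is a
`cosh` of doubled argument plus the constant `κ = cosh (π i a_{-δ} / a_δ)`. -/
lemma K_double_shift {a : ℤˣ → ℝ} (ha : ∀ δ, 0 < a δ) (δ : ℤˣ) {b x v : ℂ}
    (hx : KRegular a b (x - 2 * I * a (-δ)) v) (hx' : KRegular a b (x + 2 * I * a (-δ)) v) :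
    ∃ M κ : ℂ, ∀ X V B : ℂ, X = Real.pi * x / a δ → V = Real.pi * v / a δ →
      B = Real.pi * (I * b) / a δ →
      K a b (x - 2 * I * a (-δ)) v =
        (Complex.cosh (X - V + B) + κ) * (Complex.cosh (X + V + B) + κ) * M ∧
      K a b (x + 2 * I * a (-δ)) v =
        (Complex.cosh (X + V - B) + κ) * (Complex.cosh (X - V - B) + κ) * M ∧
      K a b x (v - 2 * I * a (-δ)) =
        (Complex.cosh (V - X + B) + κ) * (Complex.cosh (V + X + B) + κ) * M ∧
      K a b x (v + 2 * I * a (-δ)) =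
        (Complex.cosh (V + X - B) + κ) * (Complex.cosh (V - X - B) + κ) * M := by
  set κ := Complex.cosh (Real.pi * (I * a (-δ)) / a δ) with hκ
  obtain ⟨M, k1, k2, k3, k4⟩ := K_shift
    (P := fun w => 2 * (Complex.cosh (2 * (Real.pi * w / a δ)) + κ)) hx hx' (fun w hw => by
    have e0 : w - 2 * I * a (-δ) / 2 = w - I * a (-δ) := by ring
    rw [e0] at hw ⊢
    have hw' : ¬ IsGPole a w := fun h => hw (h.sub_I_mul (-δ))
    have h1 := G_add_I_mul ha δ hw
    have h2 := G_add_I_mul ha δ hw'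
    rw [sub_add_cancel, show w - I * a (-δ) + I * a (-δ) / 2 = w - I * a (-δ) / 2 by ring] at h1
    rw [show w + 2 * I * a (-δ) / 2 = w + I * a (-δ) by ring, h2, h1, ← mul_assoc]
    congr 1
    rw [c, c, two_cosh_mul_two_cosh, hκ]
    congr 3 <;> ring)
  refine ⟨4 * M, κ, ?_⟩
  rintro X V B hX hV hB
  have e1 : 2 * ((Real.pi : ℂ) * ((x + v - I * b) / 2) / a δ) = X + V - B := by
    rw [hX, hV, hB]; ring
  have e2 : 2 * ((Real.pi : ℂ) * ((x - v - I * b) / 2) / a δ) = X - V - B := by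
    rw [hX, hV, hB]; ring
  have e3 : 2 * ((Real.pi : ℂ) * ((-x + v - I * b) / 2) / a δ) = -(X - V + B) := by
    rw [hX, hV, hB]; ring
  have e4 : 2 * ((Real.pi : ℂ) * ((-x - v - I * b) / 2) / a δ) = -(X + V + B) := by
    rw [hX, hV, hB]; ring
  simp only [e1, e2, e3, e4, Complex.cosh_neg] at k1 k2 k3 k4
  refine ⟨?_, ?_, ?_, ?_⟩
  · rw [k1]; ring
  · rw [k2]; ring
  · rw [k3, show V - X + B = -(X - V - B) by ring, Complex.cosh_neg, add_comm V X]; ring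
  · rw [k4, show V - X - B = -(X - V + B) by ring, Complex.cosh_neg, add_comm V X]; ring

end RelCalogero

theorem proposition3p1 (a : ℤˣ → ℝ) (ha : ∀ δ, 0 < a δ) (δ : ℤˣ) (b d x v : ℂ) :
    -- first identity, written out and as an identity of difference operators
    (RelCalogero.s a δ x ≠ 0 → RelCalogero.s a δ v ≠ 0 →
      RelCalogero.KRegular a b (x - Complex.I * a (-δ)) v →
      RelCalogero.KRegular a b (x + Complex.I * a (-δ)) v →
      RelCalogero.KRegular a b x (v - Complex.I * a (-δ)) →
      RelCalogero.KRegular a b x (v + Complex.I * a (-δ)) →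
      RelCalogero.s a δ (x - Complex.I * b + Complex.I * d) / RelCalogero.s a δ x *
            RelCalogero.K a b (x - Complex.I * a (-δ)) v +
          RelCalogero.s a δ (x + Complex.I * b - Complex.I * d) / RelCalogero.s a δ x *
            RelCalogero.K a b (x + Complex.I * a (-δ)) v =
        RelCalogero.s a δ (v - Complex.I * d) / RelCalogero.s a δ v *
            RelCalogero.K a b x (v - Complex.I * a (-δ)) +
          RelCalogero.s a δ (v + Complex.I * d) / RelCalogero.s a δ v *
            RelCalogero.K a b x (v + Complex.I * a (-δ)) ∧
      RelCalogero.A a δ (b - d) (fun x' => RelCalogero.K a b x' v) x =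
        RelCalogero.A a δ d (fun v' => RelCalogero.K a b x v') v) ∧
    -- second identity
    (RelCalogero.s a δ x ≠ 0 → RelCalogero.s a δ v ≠ 0 →
      RelCalogero.KRegular a b (x - 2 * Complex.I * a (-δ)) v →
      RelCalogero.KRegular a b (x + 2 * Complex.I * a (-δ)) v →
      RelCalogero.KRegular a b x (v - 2 * Complex.I * a (-δ)) →
      RelCalogero.KRegular a b x (v + 2 * Complex.I * a (-δ)) →
      RelCalogero.s a δ (x - Complex.I * b) / RelCalogero.s a δ x *
            RelCalogero.K a b (x - 2 * Complex.I * a (-δ)) v +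
          RelCalogero.s a δ (x + Complex.I * b) / RelCalogero.s a δ x *
            RelCalogero.K a b (x + 2 * Complex.I * a (-δ)) v =
        RelCalogero.s a δ (v - Complex.I * b) / RelCalogero.s a δ v *
            RelCalogero.K a b x (v - 2 * Complex.I * a (-δ)) +
          RelCalogero.s a δ (v + Complex.I * b) / RelCalogero.s a δ v *
            RelCalogero.K a b x (v + 2 * Complex.I * a (-δ))) ∧
    -- third identity
    (RelCalogero.s a δ (x / 2) ≠ 0 → RelCalogero.s a δ (v / 2) ≠ 0 →
      RelCalogero.KRegular a b (x - Complex.I * a (-δ)) v →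
      RelCalogero.KRegular a b (x + Complex.I * a (-δ)) v →
      RelCalogero.KRegular a b x (v - Complex.I * a (-δ)) →
      RelCalogero.KRegular a b x (v + Complex.I * a (-δ)) →
      RelCalogero.s a δ ((x - Complex.I * b) / 2) / RelCalogero.s a δ (x / 2) *
            RelCalogero.K a b (x - Complex.I * a (-δ)) v +
          RelCalogero.s a δ ((x + Complex.I * b) / 2) / RelCalogero.s a δ (x / 2) *
            RelCalogero.K a b (x + Complex.I * a (-δ)) v =
        RelCalogero.s a δ ((v - Complex.I * b) / 2) / RelCalogero.s a δ (v / 2) *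
            RelCalogero.K a b x (v - Complex.I * a (-δ)) +
          RelCalogero.s a δ ((v + Complex.I * b) / 2) / RelCalogero.s a δ (v / 2) *
            RelCalogero.K a b x (v + Complex.I * a (-δ))) := by
  -- Each side of an identity has this shape, with `Q` the invariant cofactor; `S` cancels.
  have hcancel : ∀ {S A B Q M : ℂ}, S ≠ 0 → A + B = S * Q → A * M / S + B * M / S = Q * M := by
    intro S A B Q M hS h
    rw [← add_div, ← add_mul, h]
    field_simp
  obtain ⟨X, hX⟩ : ∃ X, X = Real.pi * x / (a δ : ℂ) := ⟨_, rfl⟩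
  obtain ⟨V, hV⟩ : ∃ V, V = Real.pi * v / (a δ : ℂ) := ⟨_, rfl⟩
  obtain ⟨B, hB⟩ : ∃ B, B = Real.pi * (Complex.I * b) / (a δ : ℂ) := ⟨_, rfl⟩
  obtain ⟨D, hD⟩ : ∃ D, D = Real.pi * (Complex.I * d) / (a δ : ℂ) := ⟨_, rfl⟩
  refine ⟨?_, ?_, ?_⟩
  · intro hsx hsv r1 r2 _ _
    have main : RelCalogero.s a δ (x - Complex.I * b + Complex.I * d) / RelCalogero.s a δ x *
            RelCalogero.K a b (x - Complex.I * a (-δ)) v +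
          RelCalogero.s a δ (x + Complex.I * b - Complex.I * d) / RelCalogero.s a δ x *
            RelCalogero.K a b (x + Complex.I * a (-δ)) v =
        RelCalogero.s a δ (v - Complex.I * d) / RelCalogero.s a δ v *
            RelCalogero.K a b x (v - Complex.I * a (-δ)) +
          RelCalogero.s a δ (v + Complex.I * d) / RelCalogero.s a δ v *
            RelCalogero.K a b x (v + Complex.I * a (-δ)) := by
      obtain ⟨M, hM⟩ := RelCalogero.K_single_shift ha δ r1 r2
      obtain ⟨k1, k2, k3, k4⟩ := hM X V B hX hV hB
      rw [k1, k2, k3, k4]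
      have s1 : RelCalogero.s a δ (x - Complex.I * b + Complex.I * d) = Complex.sinh (X - B + D) := by
        rw [RelCalogero.s, hX, hB, hD]; congr 1; ring
      have s2 : RelCalogero.s a δ (x + Complex.I * b - Complex.I * d) = Complex.sinh (X + B - D) := by
        rw [RelCalogero.s, hX, hB, hD]; congr 1; ring
      -- Written with `B - D` in place of `D`, so that the same hyperbolic identity serves the
      -- `v`-side.
      have s3 : RelCalogero.s a δ (v - Complex.I * d) = Complex.sinh (V - B + (B - D)) := by
        rw [RelCalogero.s, hV, hD]; congr 1; ring
      have s4 : RelCalogero.s a δ (v + Complex.I * d) = Complex.sinh (V + B - (B - D)) := by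
        rw [RelCalogero.s, hV, hD]; congr 1; ring
      have s5 : RelCalogero.s a δ x = Complex.sinh X := by rw [RelCalogero.s, hX]
      have s6 : RelCalogero.s a δ v = Complex.sinh V := by rw [RelCalogero.s, hV]
      rw [s5] at hsx
      rw [s6] at hsv
      rw [s1, s2, s3, s4, s5, s6]
      have t1 := hcancel (M := M) hsx (RelCalogero.sinh_mul_cosh_add_cosh X B D V)
      have t2 := hcancel (M := M) hsv (RelCalogero.sinh_mul_cosh_add_cosh V B (B - D) X)
      rw [sub_sub_cancel] at t2
      linear_combination t1 - t2
    refine ⟨main, ?_⟩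
    simp only [RelCalogero.A, RelCalogero.T, sub_neg_eq_add]
    rw [show x - Complex.I * (b - d) = x - Complex.I * b + Complex.I * d by ring,
      show x + Complex.I * (b - d) = x + Complex.I * b - Complex.I * d by ring]
    exact main
  · intro hsx hsv r1 r2 _ _
    obtain ⟨M, κ, hM⟩ := RelCalogero.K_double_shift ha δ r1 r2
    obtain ⟨k1, k2, k3, k4⟩ := hM X V B hX hV hB
    rw [k1, k2, k3, k4]
    have s1 : RelCalogero.s a δ (x - Complex.I * b) = Complex.sinh (X - B) := by
      rw [RelCalogero.s, hX, hB]; congr 1; ring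
    have s2 : RelCalogero.s a δ (x + Complex.I * b) = Complex.sinh (X + B) := by
      rw [RelCalogero.s, hX, hB]; congr 1; ring
    have s3 : RelCalogero.s a δ (v - Complex.I * b) = Complex.sinh (V - B) := by
      rw [RelCalogero.s, hV, hB]; congr 1; ring
    have s4 : RelCalogero.s a δ (v + Complex.I * b) = Complex.sinh (V + B) := by
      rw [RelCalogero.s, hV, hB]; congr 1; ring
    have s5 : RelCalogero.s a δ x = Complex.sinh X := by rw [RelCalogero.s, hX]
    have s6 : RelCalogero.s a δ v = Complex.sinh V := by rw [RelCalogero.s, hV]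
    rw [s5] at hsx
    rw [s6] at hsv
    rw [s1, s2, s3, s4, s5, s6]
    have t1 := hcancel (M := M) hsx (RelCalogero.sinh_mul_cosh_add_const_mul X B V κ)
    have t2 := hcancel (M := M) hsv (RelCalogero.sinh_mul_cosh_add_const_mul V B X κ)
    linear_combination t1 - t2
  · intro hsx hsv r1 r2 _ _
    obtain ⟨M, hM⟩ := RelCalogero.K_single_shift ha δ r1 r2
    obtain ⟨k1, k2, k3, k4⟩ := hM (2 * (X / 2)) (2 * (V / 2)) (2 * (B / 2))
      (by rw [hX]; ring) (by rw [hV]; ring) (by rw [hB]; ring)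
    rw [k1, k2, k3, k4]
    have s1 : RelCalogero.s a δ ((x - Complex.I * b) / 2) = Complex.sinh (X / 2 - B / 2) := by
      rw [RelCalogero.s, hX, hB]; congr 1; ring
    have s2 : RelCalogero.s a δ ((x + Complex.I * b) / 2) = Complex.sinh (X / 2 + B / 2) := by
      rw [RelCalogero.s, hX, hB]; congr 1; ring
    have s3 : RelCalogero.s a δ ((v - Complex.I * b) / 2) = Complex.sinh (V / 2 - B / 2) := by
      rw [RelCalogero.s, hV, hB]; congr 1; ring
    have s4 : RelCalogero.s a δ ((v + Complex.I * b) / 2) = Complex.sinh (V / 2 + B / 2) := by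
      rw [RelCalogero.s, hV, hB]; congr 1; ring
    have s5 : RelCalogero.s a δ (x / 2) = Complex.sinh (X / 2) := by
      rw [RelCalogero.s, hX]; congr 1; ring
    have s6 : RelCalogero.s a δ (v / 2) = Complex.sinh (V / 2) := by
      rw [RelCalogero.s, hV]; congr 1; ring
    rw [s5] at hsx
    rw [s6] at hsv
    rw [s1, s2, s3, s4, s5, s6]
    have t1 := hcancel (M := M) hsx (RelCalogero.sinh_half_mul_cosh_add_cosh (X / 2) (B / 2) (V / 2))
    have t2 := hcancel (M := M) hsv (RelCalogero.sinh_half_mul_cosh_add_cosh (V / 2) (B / 2) (X / 2))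
    linear_combination t1 - t2
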